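/- Let $d\ge 1$, $0<\Theta<1$, $0<p_0,p_1<\infty$, $0<q_0,q_1\le\infty$, $s_0,s_1\in\mathbb R$, and put $$\frac1p=\frac{1-\Theta}{p_0}+\frac{\Theta}{p_1},\qquad \frac1q=\frac{1-\Theta}{q_0}+\frac{\Theta}{q_1},\qquad s=(1-\Theta)s_0+\Theta s_1 ,$$ where $1/\infty=0$. Let $\mathcal A_\infty^{\ell oc}=\bigcup_{1<r<\infty}\mathcal A_r^{\ell oc}$, where $\mathcal A_r^{\ell oc}$ is the class of nonnegative, locally integrable functions $w$ on $\mathbb R^d$, not vanishing almost everywhere, with $$\sup_{B}\Big(\frac1{|B|}\int_B w(x)\,dx\Big)^{1/r}\Big(\frac1{|B|}\int_B w(x)^{-r'/r}\,dx\Big)^{1/r'}<\infty ,\qquad \frac1r+\frac1{r'}=1,$$ the supremum being taken over all balls $B\subset\mathbb R^d$ of volume $|B|\le1$. For a weight $w$, the space $f^s_{p,q}(\mathbb R^d,w)$ consists of all families $\lambda=(\lambda_{j,k})_{j\in\mathbb N_0,\,k\in\mathbb Z^d}$ of complex numbers such that $$\|\lambda\,|f^s_{p,q}(\mathbb R^d,w)\|=\bigg(\int_{\mathbb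 R^d}\Big(\sum_{j=0}^\infty\sum_{k\in\mathbb Z^d}2^{jsq}|\lambda_{j,k}|^q\,\mathcal X_{j,k}(x)\Big)^{p/q}w(x)\,dx\bigg)^{1/p}<\infty ,$$ where $\mathcal X_{j,k}$ is the characteristic function of the dyadic cube $Q_{j,k}=2^{-j}(k+[0,1)^d)$; if $q=\infty$, the inner expression $(\sum_{j,k}\cdots)^{1/q}$ is replaced by $\sup_{j,k}2^{js}|\lambda_{j,k}|\mathcal X_{j,k}(x)$. For quasi-Banach lattices $X_0,X_1$ of such families, the Calderón product $X_0^{1-\Theta}X_1^\Theta$ is the space of all families $\lambda$ for which $$\|\lambda\,|X_0^{1-\Theta}X_1^\Theta\|=\inf\Big\{\|\lambda^0|X_0\|^{1-\Theta}\,\|\lambda^1|X_1\|^{\Theta}:\ |\lambda_{j,k}|\le|\lambda^0_{j,k}|^{1-\Theta}|\lambda^1_{j,k}|^{\Theta}\text{ for all }j,k,\ \lambda^i\in X_i\ (i=0,1)\Big\}$$ is finite (with $\inf\emptyset=\infty$). Let $w_0,w_1\in\mathcal A_\infty^{\ell oc}$ and $w=w_0^{(1-\Theta)p/p_0}\,w_1^{\Theta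 p/p_1}$. Then $$f^{s_0}_{p_0,q_0}(\mathbb R^d,w_0)^{1-\Theta}\,f^{s_1}_{p_1,q_1}(\mathbb R^d,w_1)^{\Theta}=f^s_{p,q}(\mathbb R^d,w)$$ holds in the sense of equivalent quasi-norms: both sides consist of the same families, and there are constants $c,C>0$ with $$c\,\|\lambda\,|f^s_{p,q}(\mathbb R^d,w)\|\le\|\lambda\,|f^{s_0}_{p_0,q_0}(\mathbb R^d,w_0)^{1-\Theta}f^{s_1}_{p_1,q_1}(\mathbb R^d,w_1)^{\Theta}\|\le C\,\|\lambda\,|f^s_{p,q}(\mathbb R^d,w)\|$$ for all $\lambda\in f^s_{p,q}(\mathbb R^d,w)$. The limiting cases $q_0=\infty$ or $q_1=\infty$ are included. -/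

import Mathlib

open MeasureTheory
open scoped ENNReal

noncomputable section

/-- The local Muckenhoupt class `A_r^loc` on `ℝ^d`, for `1 < r < ∞`: nonnegative locally integrable
functions `w` with
`sup (1/|B| ∫_B w)^(1/r) * (1/|B| ∫_B w^(-r'/r))^(1/r') < ∞`,
the supremum running over the balls `B` of volume at most `1`. The value of `w^(-r'/r)` at a zero of
`w` is `∞`. The requirement that the second average is finite only excludes the product `0 * ∞`
(which is `0` in `ℝ≥0∞`), that is, it only excludes that `w` vanishes almost everywhere. -/
def IsLocalMuckenhoupt {d : ℕ} (r : ℝ) (w : EuclideanSpace ℝ (Fin d) → ℝ) : Prop :=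
  (∀ x, 0 ≤ w x) ∧ LocallyIntegrable w volume ∧
    ∃ C : ℝ≥0∞, C ≠ ∞ ∧
      ∀ (c : EuclideanSpace ℝ (Fin d)) (ρ : ℝ), 0 < ρ → volume (Metric.ball c ρ) ≤ 1 →
        (⨍⁻ x in Metric.ball c ρ, ENNReal.ofReal (w x) ^ (-(r.conjExponent / r)) ∂volume) ≠ ∞ ∧
        (⨍⁻ x in Metric.ball c ρ, ENNReal.ofReal (w x) ∂volume) ^ (1 / r) *
          (⨍⁻ x in Metric.ball c ρ, ENNReal.ofReal (w x) ^ (-(r.conjExponent / r)) ∂volume)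
            ^ (1 / r.conjExponent) ≤ C

/-- The class `A_∞^loc`, the union of the classes `A_r^loc` over `1 < r < ∞`. -/
def IsLocalMuckenhouptInfty {d : ℕ} (w : EuclideanSpace ℝ (Fin d) → ℝ) : Prop :=
  ∃ r : ℝ, 1 < r ∧ IsLocalMuckenhoupt r w

/-- The dyadic cube `Q_{j,k}`, of side length `2^(-j)` and with lower left corner `2^(-j) k`. -/
def dyadicCube {d : ℕ} (j : ℕ) (k : Fin d → ℤ) : Set (EuclideanSpace ℝ (Fin d)) :=
  {x | ∀ l, (2 : ℝ) ^ (-(j : ℤ)) * (k l : ℝ) ≤ x l ∧ x l < (2 : ℝ) ^ (-(j : ℤ)) * ((k l : ℝ) + 1)}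

/-- The term `2^(js) |a_{j,k}| 𝒳_{j,k}(x)`. -/
def dyadicTerm {d : ℕ} (s : ℝ) (a : ℕ × (Fin d → ℤ) → ℂ) (j : ℕ) (k : Fin d → ℤ)
    (x : EuclideanSpace ℝ (Fin d)) : ℝ≥0∞ :=
  (dyadicCube j k).indicator (fun _ => ENNReal.ofReal ((2 : ℝ) ^ (s * (j : ℝ)) * ‖a (j, k)‖)) x

/-- The function `(∑_j ∑_k 2^(jsq) |a_{j,k}|^q 𝒳_{j,k}(x))^(1/q)`, with the usual modification
`sup_{j,k} 2^(js) |a_{j,k}| 𝒳_{j,k}(x)` if `q = ∞`. -/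
def dyadicSquareFunction {d : ℕ} (s : ℝ) (q : ℝ≥0∞) (a : ℕ × (Fin d → ℤ) → ℂ)
    (x : EuclideanSpace ℝ (Fin d)) : ℝ≥0∞ :=
  if q = ∞ then ⨆ (j : ℕ) (k : Fin d → ℤ), dyadicTerm s a j k x
  else (∑' (j : ℕ) (k : Fin d → ℤ), dyadicTerm s a j k x ^ q.toReal) ^ (1 / q.toReal)

/-- The `L_p(ℝ^d, w)` quasi-norm (`0 < p < ∞`) of a function with values in `[0, ∞]`. -/
def weightedLpNorm {d : ℕ} (p : ℝ) (w : EuclideanSpace ℝ (Fin d) → ℝ)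
    (F : EuclideanSpace ℝ (Fin d) → ℝ≥0∞) : ℝ≥0∞ :=
  (∫⁻ x, F x ^ p * ENNReal.ofReal (w x) ∂volume) ^ (1 / p)

/-- The quasi-norm of `f^s_{p,q}(ℝ^d, w)`, equal to `∞` outside of the space. -/
def fNorm {d : ℕ} (s p : ℝ) (q : ℝ≥0∞) (w : EuclideanSpace ℝ (Fin d) → ℝ)
    (a : ℕ × (Fin d → ℤ) → ℂ) : ℝ≥0∞ :=
  weightedLpNorm p w (dyadicSquareFunction s q a)

/-- The space of those (classes of) `μ`-measurable functions on which an extended quasi-norm `N`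
is finite. -/
def latticeOf {X : Type*} [MeasurableSpace X] (μ : Measure X) (N : (X → ℂ) → ℝ≥0∞) :
    Set (X → ℂ) :=
  {f | AEMeasurable f μ ∧ N f < ∞}

/-- The sequence space `f^s_{p,q}(ℝ^d, w)`, as a space of functions on `ℕ × ℤ^d` with the counting
measure (so that all functions are measurable). -/
def fSpace {d : ℕ} (s p : ℝ) (q : ℝ≥0∞) (w : EuclideanSpace ℝ (Fin d) → ℝ) :
    Set (ℕ × (Fin d → ℤ) → ℂ) :=
  latticeOf Measure.count (fNorm s p q w)

/-- The quasi-norm of the Calderón product `X₀^(1-Θ) X₁^Θ`, where `X_i` consists of the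
`μ`-measurable functions with `N_i f < ∞` and has the quasi-norm `N_i`: the infimum of
`‖f₀‖^(1-Θ) ‖f₁‖^Θ` over `f₀ ∈ X₀` and `f₁ ∈ X₁` with `|f| ≤ |f₀|^(1-Θ) |f₁|^Θ` a.e.
(and `∞` if there are none). -/
def calderonNorm {X : Type*} [MeasurableSpace X] (μ : Measure X) (Θ : ℝ)
    (N₀ N₁ : (X → ℂ) → ℝ≥0∞) (f : X → ℂ) : ℝ≥0∞ :=
  ⨅ (f₀ : X → ℂ) (f₁ : X → ℂ) (_ : f₀ ∈ latticeOf μ N₀) (_ : f₁ ∈ latticeOf μ N₁)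
    (_ : ∀ᵐ x ∂μ, ‖f x‖ ≤ ‖f₀ x‖ ^ (1 - Θ) * ‖f₁ x‖ ^ Θ), N₀ f₀ ^ (1 - Θ) * N₁ f₁ ^ Θ

/-- The Calderón product `X₀^(1-Θ) X₁^Θ`. -/
def calderonProduct {X : Type*} [MeasurableSpace X] (μ : Measure X) (Θ : ℝ)
    (N₀ N₁ : (X → ℂ) → ℝ≥0∞) : Set (X → ℂ) :=
  latticeOf μ (calderonNorm μ Θ N₀ N₁)

end

/-! The lower estimate holds with constant 1. If |a| ≤ |a₀|^(1-Θ) |a₁|^Θ, Hölder's inequality in ℓ^q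
at each point and then in the integral gives `fNorm_le_of_norm_le`; the weight w is exactly the one
that Hölder produces.

The upper estimate needs a factorization (`exists_factorization`). Let g be the square function of
a, c_Q = 2^(js)|a_Q| and α_i = q/q_i, so that (1-Θ)α₀ + Θα₁ = 1. There is a monomial u in g, w₀, w₁
with (g^α₀ u^Θ)^p₀ w₀ = g^p w = (g^α₁ u^(-(1-Θ)))^p₁ w₁. If u were constant on every cube, the
factors with coefficients c_Q^α₀ u^Θ and c_Q^α₁ u^(-(1-Θ)) would do: the powers of u cancel in the
product, and both quasi-norms come from the integral of g^p w. In general u is replaced on Q by a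
Lebesgue median M_Q. Then M_Q^Θ ≤ u^Θ on {u ≥ M_Q} and M_Q^(-(1-Θ)) ≤ u^(-(1-Θ)) on {u ≤ M_Q}, and
each of these sets fills at least half of Q. The pointwise bounds thus hold once the cubes are cut
down to suitable halves.

It remains to see that cutting every cube down to a subset of at least half its volume changes the
quasi-norm of f^s_{p,q}(w) only by a constant factor, for w in A_∞^loc
(`IsLocalMuckenhoupt.exists_fNorm_rpow_le`). The Muckenhoupt condition shows that such subsets E_Q
carry a fixed share of the measure ν = w dx (`IsLocalMuckenhoupt.cubeComparable`). Hence ∫ H dν ≤ C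
∫_{E_j} H dν for H constant on the cubes of level j, where E_j is the union of the E_Q of that level
(`IsThick`). Since c_Q, summed over level j, is adapted to the dyadic filtration, powers of ∑_j
c_j^q can be expanded into adapted terms, each of which is moved to E_j separately. No maximal
inequality is used, so all 0 < p < ∞ and 0 < q ≤ ∞ are covered
(`IsThick.exists_lintegral_sequenceNorm_le`). -/

open scoped NNReal

/-! ### Elementary inequalities for powers of partial sums -/

lemma NNReal.mul_rpow_sub_one {a : ℝ≥0} {p : ℝ} (hp : p ≠ 0) : a * a ^ (p - 1) = a ^ p := by
  rcases eq_or_ne a 0 with rfl | ha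
  · simp [NNReal.zero_rpow hp]
  · rw [NNReal.rpow_sub_one ha, mul_div_cancel₀ _ ha]

/-- Bernoulli's inequality for (1 - t/(b+t))^p, multiplied by (b+t)^p. For p ≤ 1 Bernoulli reverses,
which yields `NNReal.le_add_rpow_of_le_one`. -/
lemma NNReal.add_rpow_le_of_one_le {p : ℝ} (hp : 1 ≤ p) (b t : ℝ≥0) :
    (b + t) ^ p ≤ b ^ p + p.toNNReal * (t * (b + t) ^ (p - 1)) := by
  have hp0 : 0 < p := by linarith
  rcases eq_or_ne (b + t) 0 with ha | ha
  · rw [ha, NNReal.zero_rpow hp0.ne']; exact zero_le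
  have ha' : (0 : ℝ) < b + t := by exact_mod_cast pos_iff_ne_zero.2 ha
  have h := one_add_mul_self_le_rpow_one_add (s := -(t / (b + t) : ℝ))
    (by rw [neg_le_neg_iff, div_le_one ha']; simp) hp
  have h1 : (1 : ℝ) + -(t / (b + t) : ℝ) = b / (b + t) := by field_simp; ring
  rw [h1, Real.div_rpow (by positivity) ha'.le, le_div_iff₀ (by positivity)] at h
  rw [← NNReal.coe_le_coe]
  push_cast
  rw [Real.coe_toNNReal _ hp0.le, Real.rpow_sub_one ha'.ne']
  calc ((b : ℝ) + t) ^ p = (1 + p * -(t / (b + t))) * (b + t) ^ p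
        + p * (t * ((b + t) ^ p / (b + t))) := by field_simp; ring
    _ ≤ _ := by gcongr

lemma NNReal.add_rpow_le_of_le_one {p : ℝ} (hp0 : 0 < p) (hp : p ≤ 1) (b t : ℝ≥0) :
    (b + t) ^ p ≤ b ^ p + t * (b + t) ^ (p - 1) := by
  rw [← NNReal.mul_rpow_sub_one hp0.ne', add_mul]
  gcongr
  rcases eq_or_ne b 0 with rfl | hb
  · simp
  rw [← NNReal.mul_rpow_sub_one (a := b) hp0.ne']
  exact mul_le_mul' le_rfl
    (NNReal.rpow_le_rpow_of_nonpos (pos_iff_ne_zero.2 hb) (by simp) (by linarith))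

lemma NNReal.le_add_rpow_of_le_one {p : ℝ} (hp0 : 0 < p) (hp : p ≤ 1) (b t : ℝ≥0) :
    b ^ p + p.toNNReal * (t * (b + t) ^ (p - 1)) ≤ (b + t) ^ p := by
  rcases eq_or_ne (b + t) 0 with ha | ha
  · obtain ⟨rfl, rfl⟩ := add_eq_zero.1 ha
    simp
  have ha' : (0 : ℝ) < b + t := by exact_mod_cast pos_iff_ne_zero.2 ha
  have h := rpow_one_add_le_one_add_mul_self (s := -(t / (b + t) : ℝ))
    (by rw [neg_le_neg_iff, div_le_one ha']; simp) hp0.le hp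
  have h1 : (1 : ℝ) + -(t / (b + t) : ℝ) = b / (b + t) := by field_simp; ring
  rw [h1, Real.div_rpow (by positivity) ha'.le, div_le_iff₀ (by positivity)] at h
  rw [← NNReal.coe_le_coe]
  push_cast
  rw [Real.coe_toNNReal _ hp0.le, Real.rpow_sub_one ha'.ne']
  calc (b : ℝ) ^ p + p * (t * ((b + t) ^ p / (b + t)))
      ≤ (1 + p * -(t / (b + t))) * (b + t) ^ p + p * (t * ((b + t) ^ p / (b + t))) := by gcongr
    _ = _ := by field_simp; ring

/-- Telescoping of the one-step inequality. The partial sum next to `b j` includes the index `j` and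
nothing later, so the terms stay adapted when the `b j` are. -/
lemma NNReal.sum_rpow_le_of_one_le {p : ℝ} (hp : 1 ≤ p) (b : ℕ → ℝ≥0) (n : ℕ) :
    (∑ j ∈ Finset.range n, b j) ^ p ≤
      p.toNNReal * ∑ j ∈ Finset.range n, b j * (∑ i ∈ Finset.range (j + 1), b i) ^ (p - 1) := by
  induction n with
  | zero => simp [NNReal.zero_rpow (by linarith : p ≠ 0)]
  | succ n ih =>
    rw [Finset.sum_range_succ _ n, Finset.sum_range_succ _ n, mul_add]
    refine (NNReal.add_rpow_le_of_one_le hp _ _).trans ?_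
    rw [← Finset.sum_range_succ]
    gcongr

lemma NNReal.sum_rpow_le_of_le_one {p : ℝ} (hp0 : 0 < p) (hp : p ≤ 1) (b : ℕ → ℝ≥0) (n : ℕ) :
    (∑ j ∈ Finset.range n, b j) ^ p ≤
      ∑ j ∈ Finset.range n, b j * (∑ i ∈ Finset.range (j + 1), b i) ^ (p - 1) := by
  induction n with
  | zero => simp [NNReal.zero_rpow hp0.ne']
  | succ n ih =>
    rw [Finset.sum_range_succ _ n, Finset.sum_range_succ _ n]
    refine (NNReal.add_rpow_le_of_le_one hp0 hp _ _).trans ?_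
    rw [← Finset.sum_range_succ]
    gcongr

lemma NNReal.le_sum_rpow_of_le_one {p : ℝ} (hp0 : 0 < p) (hp : p ≤ 1) (b : ℕ → ℝ≥0) (n : ℕ) :
    p.toNNReal * ∑ j ∈ Finset.range n, b j * (∑ i ∈ Finset.range (j + 1), b i) ^ (p - 1) ≤
      (∑ j ∈ Finset.range n, b j) ^ p := by
  induction n with
  | zero => simp
  | succ n ih =>
    rw [Finset.sum_range_succ _ n, Finset.sum_range_succ _ n, mul_add]
    refine le_trans ?_ (NNReal.le_add_rpow_of_le_one hp0 hp _ _)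
    rw [← Finset.sum_range_succ]
    gcongr

/-- The increments of the running maximum of `b`. -/
def recordIncrement (b : ℕ → ℝ≥0) (n : ℕ) : ℝ≥0 := b n - (Finset.range n).sup b

lemma sum_recordIncrement (b : ℕ → ℝ≥0) (n : ℕ) :
    ∑ j ∈ Finset.range n, recordIncrement b j = (Finset.range n).sup b := by
  induction n with
  | zero => simp
  | succ n ih =>
    rw [Finset.sum_range_succ, ih, Finset.range_add_one, Finset.sup_insert, recordIncrement,
      add_tsub_eq_max]
    exact max_comm _ _

/-- When a new record occurs at an index in `s`, the selected increments before it sum to at most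
the old maximum, so adding the new increment gives at most `b n`. -/
lemma sum_indicator_recordIncrement_le (b : ℕ → ℝ≥0) (s : Set ℕ) (n : ℕ) :
    ∑ j ∈ Finset.range n, s.indicator (recordIncrement b) j ≤
      (Finset.range n).sup (s.indicator b) := by
  induction n with
  | zero => simp
  | succ n ih =>
    rw [Finset.sum_range_succ, Finset.range_add_one, Finset.sup_insert]
    by_cases hn : n ∈ s
    · rw [Set.indicator_of_mem hn, Set.indicator_of_mem hn]
      rcases le_total (b n) ((Finset.range n).sup b) with h | h
      · rw [recordIncrement, tsub_eq_zero_of_le h, add_zero]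
        exact ih.trans le_sup_right
      · refine le_trans ?_ le_sup_left
        have h1 : (Finset.range n).sup (s.indicator b) ≤ (Finset.range n).sup b :=
          Finset.sup_mono_fun fun j _ => Set.indicator_le_self s b j
        calc _ ≤ (Finset.range n).sup b + recordIncrement b n := by gcongr; exact ih.trans h1
          _ = b n := by rw [recordIncrement, add_tsub_cancel_of_le h]
    · rw [Set.indicator_of_notMem hn, add_zero]
      exact ih.trans le_sup_right

/-! ### Domination by thick subsets along a filtration -/

/-- The sets `E j` are thick with respect to the filtration `ℱ`: on the `j`-th level they carry a
fixed portion of the integral of every nonnegative `ℱ j`-measurable function. -/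
structure IsThick {X : Type*} {m : MeasurableSpace X} (ν : Measure X) (ℱ : Filtration ℕ m)
    (E : ℕ → Set X) (C : ℝ≥0∞) : Prop where
  measurableSet : ∀ j, MeasurableSet (E j)
  lintegral_le : ∀ (j : ℕ) (H : X → ℝ≥0∞), Measurable[ℱ j] H →
    ∫⁻ x, H x ∂ν ≤ C * ∫⁻ x in E j, H x ∂ν

namespace IsThick

variable {X : Type*} {m : MeasurableSpace X} {ν : Measure X} {ℱ : Filtration ℕ m}
  {E : ℕ → Set X} {C : ℝ≥0∞} {b : ℕ → X → ℝ≥0}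

lemma lintegral_sum_le (hE : IsThick ν ℱ E C) (n : ℕ) {H : ℕ → X → ℝ≥0}
    (hH : ∀ j, Measurable[ℱ j] (H j)) :
    ∫⁻ x, ((∑ j ∈ Finset.range n, H j x : ℝ≥0) : ℝ≥0∞) ∂ν ≤
      C * ∫⁻ x, ((∑ j ∈ Finset.range n, (E j).indicator (H j) x : ℝ≥0) : ℝ≥0∞) ∂ν := by
  have hm : ∀ j, Measurable (H j) := fun j => (hH j).mono (ℱ.le j) le_rfl
  have hi : ∀ j, Measurable ((E j).indicator (H j)) := fun j => (hm j).indicator (hE.1 j)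
  simp only [ENNReal.ofNNReal_finsetSum]
  rw [lintegral_finsetSum _ fun j _ => (hm j).coe_nnreal_ennreal,
    lintegral_finsetSum _ fun j _ => (hi j).coe_nnreal_ennreal, Finset.mul_sum]
  refine Finset.sum_le_sum fun j _ => ?_
  refine (hE.2 j _ ((hH j).coe_nnreal_ennreal)).trans_eq ?_
  rw [← lintegral_indicator (hE.1 j)]
  congr 1
  refine lintegral_congr fun x => ?_
  by_cases hx : x ∈ E j <;> simp [hx]

lemma measurable_mul_sum_rpow (hb : ∀ j, Measurable[ℱ j] (b j)) (r : ℝ) (j : ℕ) :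
    Measurable[ℱ j] fun x => b j x * (∑ i ∈ Finset.range (j + 1), b i x) ^ r := by
  refine Measurable.mul (hb j) (Measurable.pow_const ?_ r)
  refine Finset.measurable_sum _ fun i hi => (hb i).mono (ℱ.mono ?_) le_rfl
  exact Nat.lt_succ_iff.1 (Finset.mem_range.1 hi)

/-- The power is expanded into adapted terms, which are moved to the sets `E j`. As p - 1 ≤ 0,
shrinking the partial sums to their restricted versions only increases the terms, and the reverse
telescoping inequality reassembles the restricted power. -/
lemma lintegral_sum_rpow_le_of_le_one (hE : IsThick ν ℱ E C) (hb : ∀ j, Measurable[ℱ j] (b j))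
    {p : ℝ} (hp0 : 0 < p) (hp : p ≤ 1) (n : ℕ) :
    ENNReal.ofReal p * ∫⁻ x, ((∑ j ∈ Finset.range n, b j x : ℝ≥0) : ℝ≥0∞) ^ p ∂ν ≤
      C * ∫⁻ x, ((∑ j ∈ Finset.range n, (E j).indicator (b j) x : ℝ≥0) : ℝ≥0∞) ^ p ∂ν := by
  simp only [← ENNReal.coe_rpow_of_nonneg _ hp0.le]
  calc _ ≤ ENNReal.ofReal p * ∫⁻ x, ((∑ j ∈ Finset.range n,
            b j x * (∑ i ∈ Finset.range (j + 1), b i x) ^ (p - 1) : ℝ≥0) : ℝ≥0∞) ∂ν := by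
        gcongr with x
        exact NNReal.sum_rpow_le_of_le_one hp0 hp (fun j => b j x) n
    _ ≤ ENNReal.ofReal p * (C * ∫⁻ x, ((∑ j ∈ Finset.range n, (E j).indicator (fun x =>
            b j x * (∑ i ∈ Finset.range (j + 1), b i x) ^ (p - 1)) x : ℝ≥0) : ℝ≥0∞) ∂ν) := by
        gcongr
        exact hE.lintegral_sum_le n (measurable_mul_sum_rpow hb (p - 1))
    _ = C * ∫⁻ x, ((p.toNNReal * ∑ j ∈ Finset.range n, (E j).indicator (fun x =>
            b j x * (∑ i ∈ Finset.range (j + 1), b i x) ^ (p - 1)) x : ℝ≥0) : ℝ≥0∞) ∂ν := by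
        rw [mul_left_comm]
        congr 1
        rw [← lintegral_const_mul']
        · simp [ENNReal.ofReal]
        · simp
    _ ≤ _ := by
        gcongr with x
        refine le_trans ?_ (NNReal.le_sum_rpow_of_le_one hp0 hp
          (fun j => (E j).indicator (b j) x) n)
        gcongr with j _
        by_cases hx : x ∈ E j
        · simp only [Set.indicator_of_mem hx]
          -- Negative powers of 0 are 0 in `ℝ≥0`, so antitonicity requires a positive base; the term
          -- `b j x` itself makes the restricted sum positive.
          rcases eq_or_ne (b j x) 0 with h0 | h0
          · simp [h0]
          refine mul_le_mul' le_rfl (NNReal.rpow_le_rpow_of_nonpos ?_ ?_ (by linarith))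
          · rw [Finset.sum_range_succ, Set.indicator_of_mem hx]
            exact add_pos_of_nonneg_of_pos zero_le (pos_iff_ne_zero.2 h0)
          · exact Finset.sum_le_sum fun i _ => Set.indicator_le_self _ _ _
        · simp [hx]

/-- Now p - 1 ≥ 0, so the partial sums are bounded by the full sum G. Hölder gives I ≤ p C J^(1/p)
I^(1-1/p), and the last power is absorbed on the left, which is where finiteness of I enters. -/
lemma lintegral_sum_rpow_le_of_one_le_of_ne_top (hE : IsThick ν ℱ E C)
    (hb : ∀ j, Measurable[ℱ j] (b j)) {p : ℝ} (hp : 1 ≤ p) (n : ℕ)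
    (hfin : ∫⁻ x, ((∑ j ∈ Finset.range n, b j x : ℝ≥0) : ℝ≥0∞) ^ p ∂ν ≠ ∞) :
    ∫⁻ x, ((∑ j ∈ Finset.range n, b j x : ℝ≥0) : ℝ≥0∞) ^ p ∂ν ≤
      (ENNReal.ofReal p * C) ^ p *
        ∫⁻ x, ((∑ j ∈ Finset.range n, (E j).indicator (b j) x : ℝ≥0) : ℝ≥0∞) ^ p ∂ν := by
  have hp0 : 0 < p := by linarith
  have hm : ∀ j, Measurable (b j) := fun j => (hb j).mono (ℱ.le j) le_rfl
  set G : X → ℝ≥0 := fun x => ∑ j ∈ Finset.range n, b j x with hG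
  set F : X → ℝ≥0 := fun x => ∑ j ∈ Finset.range n, (E j).indicator (b j) x with hF
  have hGm : Measurable G := Finset.measurable_sum _ fun j _ => hm j
  have hFm : Measurable F := Finset.measurable_sum _ fun j _ => (hm j).indicator (hE.1 j)
  set I := ∫⁻ x, (G x : ℝ≥0∞) ^ p ∂ν with hI
  set J := ∫⁻ x, (F x : ℝ≥0∞) ^ p ∂ν with hJ
  have key : I ≤ ENNReal.ofReal p * C * (J ^ (1 / p) * I ^ (1 - 1 / p)) := by
    calc I ≤ ∫⁻ x, ((p.toNNReal * ∑ j ∈ Finset.range n,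
            b j x * (∑ i ∈ Finset.range (j + 1), b i x) ^ (p - 1) : ℝ≥0) : ℝ≥0∞) ∂ν := by
          simp only [hI, ← ENNReal.coe_rpow_of_nonneg _ hp0.le]
          gcongr with x
          exact NNReal.sum_rpow_le_of_one_le hp (fun j => b j x) n
      _ = ENNReal.ofReal p * ∫⁻ x, ((∑ j ∈ Finset.range n,
            b j x * (∑ i ∈ Finset.range (j + 1), b i x) ^ (p - 1) : ℝ≥0) : ℝ≥0∞) ∂ν := by
          rw [← lintegral_const_mul' _ _ ENNReal.ofReal_ne_top]
          simp [ENNReal.ofReal]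
      _ ≤ ENNReal.ofReal p * (C * ∫⁻ x, ((∑ j ∈ Finset.range n, (E j).indicator (fun x =>
            b j x * (∑ i ∈ Finset.range (j + 1), b i x) ^ (p - 1)) x : ℝ≥0) : ℝ≥0∞) ∂ν) := by
          gcongr
          exact hE.lintegral_sum_le n (measurable_mul_sum_rpow hb (p - 1))
      _ ≤ ENNReal.ofReal p * (C * ∫⁻ x, ((F x * G x ^ (p - 1) : ℝ≥0) : ℝ≥0∞) ∂ν) := by
          gcongr with x
          rw [hF, Finset.sum_mul]
          refine Finset.sum_le_sum fun j hj => ?_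
          by_cases hx : x ∈ E j
          · simp only [Set.indicator_of_mem hx]
            refine mul_le_mul' le_rfl (NNReal.rpow_le_rpow ?_ (by linarith))
            refine Finset.sum_le_sum_of_subset ?_
            exact Finset.range_mono (Finset.mem_range.1 hj)
          · simp [hx]
      _ = ENNReal.ofReal p * C * ∫⁻ x, ((F x : ℝ≥0∞) ^ p) ^ (1 / p) *
            ((G x : ℝ≥0∞) ^ p) ^ (1 - 1 / p) ∂ν := by
          rw [← mul_assoc]
          congr 1
          refine lintegral_congr fun x => ?_
          rw [← ENNReal.rpow_mul, ← ENNReal.rpow_mul, mul_one_div_cancel hp0.ne',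
            ENNReal.rpow_one, mul_sub, mul_one, mul_one_div_cancel hp0.ne', ENNReal.coe_mul,
            ENNReal.coe_rpow_of_nonneg _ (by linarith)]
      _ ≤ _ := by
          gcongr
          refine ENNReal.lintegral_mul_norm_pow_le
            (hFm.coe_nnreal_ennreal.pow_const p).aemeasurable
            (hGm.coe_nnreal_ennreal.pow_const p).aemeasurable (by positivity) ?_ (by ring)
          rw [sub_nonneg, div_le_one hp0]; exact hp
  rcases eq_or_ne I 0 with h0 | h0
  · rw [h0]; exact zero_le
  have h1 : I ^ (1 / p) ≤ ENNReal.ofReal p * C * J ^ (1 / p) := by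
    have hI0 : I ^ (1 - 1 / p) ≠ 0 := by simp [h0, hfin]
    have hI1 : I ^ (1 - 1 / p) ≠ ∞ := by simp [h0, hfin]
    rw [← ENNReal.mul_le_mul_iff_left hI0 hI1, ← ENNReal.rpow_add _ _ h0 hfin]
    simpa [mul_assoc] using key
  calc I = (I ^ (1 / p)) ^ p := by
        rw [← ENNReal.rpow_mul, one_div_mul_cancel hp0.ne', ENNReal.rpow_one]
    _ ≤ (ENNReal.ofReal p * C * J ^ (1 / p)) ^ p := by gcongr
    _ = _ := by
        rw [ENNReal.mul_rpow_of_nonneg _ _ hp0.le, ← ENNReal.rpow_mul,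
          one_div_mul_cancel hp0.ne', ENNReal.rpow_one]

lemma tendsto_lintegral_of_monotone {f : ℕ → X → ℝ≥0∞} {g : X → ℝ≥0∞} {p : ℝ} (hp : 0 < p)
    (hf : ∀ n, Measurable (f n)) (hmono : ∀ x, Monotone fun n => f n x)
    (hlim : ∀ x, Filter.Tendsto (fun n => f n x) Filter.atTop (nhds (g x))) :
    Filter.Tendsto (fun n => ∫⁻ x, f n x ^ p ∂ν) Filter.atTop (nhds (∫⁻ x, g x ^ p ∂ν)) :=
  lintegral_tendsto_of_tendsto_of_monotone (fun n => ((hf n).pow_const p).aemeasurable)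
    (.of_forall fun x _ _ h => ENNReal.rpow_le_rpow (hmono x h) hp.le)
    (.of_forall fun x => (ENNReal.continuous_rpow_const.tendsto _).comp (hlim x))

lemma sum_indicator_le_tsum (n : ℕ) (x : X) :
    ((∑ j ∈ Finset.range n, (E j).indicator (b j) x : ℝ≥0) : ℝ≥0∞) ≤
      ∑' j, (((E j).indicator (b j) x : ℝ≥0) : ℝ≥0∞) := by
  rw [ENNReal.ofNNReal_finsetSum]
  exact ENNReal.sum_le_tsum _

lemma lintegral_tsum_rpow_le_of_le_one (hE : IsThick ν ℱ E C) (hb : ∀ j, Measurable[ℱ j] (b j))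
    {p : ℝ} (hp0 : 0 < p) (hp : p ≤ 1) :
    ∫⁻ x, (∑' j, (b j x : ℝ≥0∞)) ^ p ∂ν ≤
      (ENNReal.ofReal p)⁻¹ * C *
        ∫⁻ x, (∑' j, (((E j).indicator (b j) x : ℝ≥0) : ℝ≥0∞)) ^ p ∂ν := by
  have hm : ∀ j, Measurable (b j) := fun j => (hb j).mono (ℱ.le j) le_rfl
  refine le_of_tendsto (tendsto_lintegral_of_monotone hp0
    (fun n => Finset.measurable_sum (Finset.range n) fun j _ => (hm j).coe_nnreal_ennreal)
    (fun x k n h => Finset.sum_le_sum_of_subset (Finset.range_mono h))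
    fun x => ENNReal.tendsto_nat_tsum fun j => (b j x : ℝ≥0∞)) (.of_forall fun n => ?_)
  have h := hE.lintegral_sum_rpow_le_of_le_one hb hp0 hp n
  have hp' : ENNReal.ofReal p ≠ 0 := by simpa using hp0
  calc _ = (ENNReal.ofReal p)⁻¹ * (ENNReal.ofReal p *
        ∫⁻ x, ((∑ j ∈ Finset.range n, b j x : ℝ≥0) : ℝ≥0∞) ^ p ∂ν) := by
        rw [← mul_assoc, ENNReal.inv_mul_cancel hp' ENNReal.ofReal_ne_top, one_mul]
        simp
    _ ≤ (ENNReal.ofReal p)⁻¹ *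
        (C * ∫⁻ x, (∑' j, (((E j).indicator (b j) x : ℝ≥0) : ℝ≥0∞)) ^ p ∂ν) := by
        refine mul_le_mul' le_rfl (h.trans ?_)
        gcongr with x
        exact sum_indicator_le_tsum n x
    _ = _ := by rw [mul_assoc]

/-- Truncation in height and to the sets `K n` supplies the finiteness needed for the absorption.
Because `K n` belongs to `ℱ 0`, the truncated functions are still adapted. -/
lemma lintegral_tsum_rpow_le_of_one_le (hE : IsThick ν ℱ E C) (hb : ∀ j, Measurable[ℱ j] (b j))
    {K : ℕ → Set X} (hK : ∀ n, MeasurableSet[ℱ 0] (K n)) (hKν : ∀ n, ν (K n) ≠ ∞)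
    (hKm : Monotone K) (hKu : ∀ x, ∃ n, x ∈ K n) {p : ℝ} (hp : 1 ≤ p) :
    ∫⁻ x, (∑' j, (b j x : ℝ≥0∞)) ^ p ∂ν ≤
      (ENNReal.ofReal p * C) ^ p *
        ∫⁻ x, (∑' j, (((E j).indicator (b j) x : ℝ≥0) : ℝ≥0∞)) ^ p ∂ν := by
  have hp0 : 0 < p := by linarith
  set t : ℕ → ℕ → X → ℝ≥0 := fun n j => (K n).indicator fun x => min (b j x) n with ht
  have htm : ∀ n j, Measurable[ℱ j] (t n j) := fun n j =>
    ((hb j).min measurable_const).indicator (ℱ.mono (Nat.zero_le j) _ (hK n))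
  have htb : ∀ n j x, t n j x ≤ b j x := fun n j x =>
    (Set.indicator_le_self _ _ x).trans (min_le_left _ _)
  have htmono : ∀ j x, Monotone fun n => t n j x := by
    intro j x n k h
    by_cases hx : x ∈ K n
    · simp only [ht, Set.indicator_of_mem hx, Set.indicator_of_mem (hKm h hx)]
      gcongr
    · simp [ht, hx]
  have hmono : ∀ x, Monotone fun n => ((∑ j ∈ Finset.range n, t n j x : ℝ≥0) : ℝ≥0∞) := by
    intro x n k h
    rw [ENNReal.coe_le_coe]
    exact (Finset.sum_le_sum fun j _ => htmono j x h).trans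
      (Finset.sum_le_sum_of_subset (Finset.range_mono h))
  refine le_of_tendsto (tendsto_lintegral_of_monotone hp0
    (f := fun n x => ((∑ j ∈ Finset.range n, t n j x : ℝ≥0) : ℝ≥0∞))
    (fun n => (Finset.measurable_sum (Finset.range n) fun j _ =>
      (htm n j).mono (ℱ.le j) le_rfl).coe_nnreal_ennreal) hmono fun x => ?_)
    (.of_forall fun n => ?_)
  · have h := tendsto_atTop_iSup (hmono x)
    suffices h' : ⨆ n, ((∑ j ∈ Finset.range n, t n j x : ℝ≥0) : ℝ≥0∞) =
        ∑' j, (b j x : ℝ≥0∞) by rwa [h'] at h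
    refine le_antisymm (iSup_le fun n => ?_) ?_
    · rw [ENNReal.ofNNReal_finsetSum]
      exact (Finset.sum_le_sum fun j _ => ENNReal.coe_le_coe.2 (htb n j x)).trans
        (ENNReal.sum_le_tsum _)
    · rw [ENNReal.tsum_eq_iSup_nat]
      refine iSup_le fun n => ?_
      obtain ⟨k, hk⟩ := hKu x
      obtain ⟨l, hl⟩ := exists_nat_ge ((Finset.range n).sup fun j => b j x)
      refine le_trans ?_ (le_iSup _ (max n (max k l)))
      rw [← ENNReal.ofNNReal_finsetSum, ENNReal.coe_le_coe]
      refine le_trans (Finset.sum_le_sum fun j hj => ?_)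
        (Finset.sum_le_sum_of_subset (Finset.range_mono (le_max_left _ _)))
      have hx : x ∈ K (max n (max k l)) :=
        hKm ((le_max_left _ _).trans (le_max_right _ _)) hk
      simp only [ht, Set.indicator_of_mem hx]
      refine le_min le_rfl (((Finset.le_sup (f := fun j => b j x) hj).trans hl).trans ?_)
      exact_mod_cast (le_max_right _ _).trans (le_max_right _ _)
  · refine (hE.lintegral_sum_rpow_le_of_one_le_of_ne_top (htm n) hp n ?_).trans ?_
    · refine ne_top_of_le_ne_top (b := ((n * n : ℕ) : ℝ≥0∞) ^ p * ν (K n)) ?_ ?_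
      · exact ENNReal.mul_ne_top (ENNReal.rpow_ne_top_of_nonneg hp0.le (ENNReal.natCast_ne_top _))
          (hKν n)
      · rw [← lintegral_indicator_const (ℱ.le 0 _ (hK n))]
        refine lintegral_mono fun x => ?_
        by_cases hx : x ∈ K n
        · rw [Set.indicator_of_mem hx]
          refine ENNReal.rpow_le_rpow ?_ hp0.le
          rw [← ENNReal.coe_natCast, ENNReal.coe_le_coe]
          refine (Finset.sum_le_card_nsmul _ _ (n : ℝ≥0) fun j _ => ?_).trans ?_
          · simp [ht, hx]
          · simp
        · simp [ht, hx, ENNReal.zero_rpow_of_pos hp0]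
    · gcongr with x
      refine le_trans ?_ (sum_indicator_le_tsum n x)
      rw [ENNReal.coe_le_coe]
      refine Finset.sum_le_sum fun j _ => ?_
      exact Set.indicator_le_indicator (htb n j x)

lemma measurable_finset_sup (hb : ∀ j, Measurable[ℱ j] (b j)) (n : ℕ) :
    Measurable[ℱ n] fun x => (Finset.range n).sup fun j => b j x := by
  suffices h : ∀ k ≤ n, Measurable[ℱ n] fun x => (Finset.range k).sup fun j => b j x from
    h n le_rfl
  intro k hk
  induction k with
  | zero => simp
  | succ k ih =>
    simp only [Finset.range_add_one, Finset.sup_insert]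
    exact ((hb k).mono (ℱ.mono (by omega)) le_rfl).sup (ih (by omega))

/-- A running maximum is the sum of its record increments, which are adapted, so the supremum
reduces to the linear case. -/
lemma lintegral_iSup_le (hE : IsThick ν ℱ E C) (hb : ∀ j, Measurable[ℱ j] (b j)) :
    ∫⁻ x, ⨆ j, (b j x : ℝ≥0∞) ∂ν ≤
      C * ∫⁻ x, ⨆ j, (((E j).indicator (b j) x : ℝ≥0) : ℝ≥0∞) ∂ν := by
  have hm : ∀ j, Measurable (b j) := fun j => (hb j).mono (ℱ.le j) le_rfl
  have hsup : ∀ x, ⨆ j, (b j x : ℝ≥0∞) =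
      ⨆ n, (((Finset.range n).sup fun j => b j x : ℝ≥0) : ℝ≥0∞) := by
    intro x
    refine le_antisymm (iSup_le fun j => ?_) (iSup_le fun n => ?_)
    · refine le_trans ?_ (le_iSup _ (j + 1))
      rw [ENNReal.coe_le_coe]
      exact Finset.le_sup (f := fun j => b j x) (Finset.self_mem_range_succ j)
    · rw [ENNReal.coe_finset_sup]
      exact Finset.sup_le fun j _ => le_iSup (fun j => (b j x : ℝ≥0∞)) j
  simp only [hsup]
  rw [lintegral_iSup (fun n => ((measurable_finset_sup hb n).mono (ℱ.le n)
    le_rfl).coe_nnreal_ennreal) fun k n h x => ENNReal.coe_le_coe.2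
      (Finset.sup_mono (Finset.range_mono h))]
  refine iSup_le fun n => ?_
  calc _ = ∫⁻ x, ((∑ j ∈ Finset.range n,
          recordIncrement (fun j => b j x) j : ℝ≥0) : ℝ≥0∞) ∂ν := by
        refine lintegral_congr fun x => ?_
        rw [sum_recordIncrement]
    _ ≤ C * ∫⁻ x, ((∑ j ∈ Finset.range n, (E j).indicator
          (fun x => recordIncrement (fun j => b j x) j) x : ℝ≥0) : ℝ≥0∞) ∂ν :=
        hE.lintegral_sum_le n fun j => (hb j).sub (measurable_finset_sup hb j)
    _ ≤ _ := by
        gcongr with x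
        have h := sum_indicator_recordIncrement_le (fun j => b j x) {j | x ∈ E j} n
        have h2 := ENNReal.coe_le_coe.2 h
        refine le_trans (le_of_eq ?_) (h2.trans ?_)
        · rfl
        · rw [ENNReal.coe_finset_sup]
          exact Finset.sup_le fun j _ =>
            le_iSup (fun j => (((E j).indicator (b j) x : ℝ≥0) : ℝ≥0∞)) j

end IsThick

/-- The (quasi-)norm of `ℓ^q` for sequences with values in `[0, ∞]`. -/
noncomputable def sequenceNorm (q : ℝ≥0∞) (b : ℕ → ℝ≥0∞) : ℝ≥0∞ :=
  if q = ∞ then ⨆ j, b j else (∑' j, b j ^ q.toReal) ^ (1 / q.toReal)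

lemma sequenceNorm_mono {q : ℝ≥0∞} {a b : ℕ → ℝ≥0∞} (h : ∀ j, a j ≤ b j) :
    sequenceNorm q a ≤ sequenceNorm q b := by
  unfold sequenceNorm
  split_ifs
  · exact iSup_mono h
  · refine ENNReal.rpow_le_rpow (ENNReal.tsum_le_tsum fun j => ?_) (by positivity)
    exact ENNReal.rpow_le_rpow (h j) (by positivity)

lemma ENNReal.iSup_rpow {ι : Sort*} (f : ι → ℝ≥0∞) {p : ℝ} (hp : 0 < p) :
    (⨆ i, f i) ^ p = ⨆ i, f i ^ p :=
  (ENNReal.orderIsoRpow p hp).map_iSup f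

lemma Set.indicator_rpow_apply {X : Type*} (s : Set X) (f : X → ℝ≥0) {p : ℝ} (hp : p ≠ 0) (x : X) :
    s.indicator (fun x => f x ^ p) x = s.indicator f x ^ p := by
  by_cases hx : x ∈ s <;> simp [hx, NNReal.zero_rpow hp]

/-- For q = ∞ the supremum estimate is applied to the powers b_j^p; for q < ∞ the sum estimates are
applied to b_j^q with the exponent p/q. The constant is independent of `E` and `b`, as it must be
since the sets arising from medians depend on the family. -/
theorem IsThick.exists_lintegral_sequenceNorm_le {X : Type*} {m : MeasurableSpace X} {ν : Measure X}
    {ℱ : Filtration ℕ m} {C : ℝ≥0∞} (hC : C ≠ ∞)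
    {K : ℕ → Set X} (hK : ∀ n, MeasurableSet[ℱ 0] (K n)) (hKν : ∀ n, ν (K n) ≠ ∞)
    (hKm : Monotone K) (hKu : ∀ x, ∃ n, x ∈ K n) {p : ℝ} (hp : 0 < p) {q : ℝ≥0∞} (hq : 0 < q) :
    ∃ C' : ℝ≥0∞, C' ≠ ∞ ∧ ∀ (E : ℕ → Set X) (b : ℕ → X → ℝ≥0), IsThick ν ℱ E C →
      (∀ j, Measurable[ℱ j] (b j)) →
      ∫⁻ x, sequenceNorm q (fun j => b j x) ^ p ∂ν ≤
        C' * ∫⁻ x, sequenceNorm q (fun j => ((E j).indicator (b j) x : ℝ≥0)) ^ p ∂ν := by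
  by_cases hqt : q = ∞
  · refine ⟨C, hC, fun E b hE hb => ?_⟩
    have h := hE.lintegral_iSup_le (b := fun j x => b j x ^ p) fun j => (hb j).pow_const p
    simpa only [sequenceNorm, hqt, if_true, ENNReal.iSup_rpow _ hp,
      ← ENNReal.coe_rpow_of_nonneg _ hp.le, Set.indicator_rpow_apply _ _ hp.ne'] using h
  · have hq' : 0 < q.toReal := ENNReal.toReal_pos hq.ne' hqt
    have hpq : 0 < 1 / q.toReal * p := by positivity
    suffices h : ∃ C' : ℝ≥0∞, C' ≠ ∞ ∧ ∀ (E : ℕ → Set X) (b : ℕ → X → ℝ≥0), IsThick ν ℱ E C →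
        (∀ j, Measurable[ℱ j] (b j)) →
        ∫⁻ x, (∑' j, (b j x : ℝ≥0∞)) ^ (1 / q.toReal * p) ∂ν ≤ C' *
          ∫⁻ x, (∑' j, (((E j).indicator (b j) x : ℝ≥0) : ℝ≥0∞)) ^ (1 / q.toReal * p) ∂ν by
      obtain ⟨C', hC', h⟩ := h
      refine ⟨C', hC', fun E b hE hb => ?_⟩
      have h := h E (fun j x => b j x ^ q.toReal) hE fun j => (hb j).pow_const _
      simpa only [sequenceNorm, hqt, if_false, ← ENNReal.rpow_mul,
        ← ENNReal.coe_rpow_of_nonneg _ hq'.le, Set.indicator_rpow_apply _ _ hq'.ne'] using h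
    rcases le_total (1 / q.toReal * p) 1 with h1 | h1
    · refine ⟨_, ?_, fun E b hE hb => hE.lintegral_tsum_rpow_le_of_le_one hb hpq h1⟩
      exact ENNReal.mul_ne_top (by simpa [hp] using hq') hC
    · refine ⟨_, ?_, fun E b hE hb =>
        hE.lintegral_tsum_rpow_le_of_one_le hb hK hKν hKm hKu h1⟩
      exact ENNReal.rpow_ne_top_of_nonneg hpq.le (ENNReal.mul_ne_top ENNReal.ofReal_ne_top hC)

/-! ### Dyadic cubes and the dyadic filtration -/

section Dyadic

variable {d : ℕ}

/-- The index `k` of the dyadic cube of the level `j` that contains `x`. -/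
noncomputable def dyadicIndex (j : ℕ) (x : EuclideanSpace ℝ (Fin d)) : Fin d → ℤ :=
  fun l => ⌊(2 : ℝ) ^ j * x l⌋

lemma mem_dyadicCube_iff {j : ℕ} {k : Fin d → ℤ} {x : EuclideanSpace ℝ (Fin d)} :
    x ∈ dyadicCube j k ↔ dyadicIndex j x = k := by
  have h2 : (0 : ℝ) < 2 ^ j := by positivity
  simp only [dyadicCube, Set.mem_ofPred_eq, dyadicIndex, funext_iff]
  refine forall_congr' fun l => ?_
  rw [Int.floor_eq_iff, zpow_neg, zpow_natCast, inv_mul_le_iff₀ h2, lt_inv_mul_iff₀ h2]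

lemma preimage_dyadicIndex (j : ℕ) (k : Fin d → ℤ) :
    dyadicIndex j ⁻¹' {k} = dyadicCube j k := by
  ext x; exact mem_dyadicCube_iff.symm

lemma measurable_dyadicIndex (j : ℕ) : Measurable (dyadicIndex (d := d) j) := by
  refine measurable_pi_lambda _ fun l => Int.measurable_floor.comp ?_
  fun_prop

lemma measurableSet_dyadicCube (j : ℕ) (k : Fin d → ℤ) : MeasurableSet (dyadicCube j k) := by
  rw [← preimage_dyadicIndex]
  exact measurable_dyadicIndex j (measurableSet_singleton k)

lemma dyadicIndex_eq_of_succ (j : ℕ) (x : EuclideanSpace ℝ (Fin d)) :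
    dyadicIndex j x = fun l => dyadicIndex (j + 1) x l / 2 := by
  funext l
  have h : (2 : ℝ) ^ j * x l = (2 ^ (j + 1) * x l) / (2 : ℕ) := by push_cast; ring
  simp only [dyadicIndex]
  rw [h, Int.floor_div_natCast]
  rfl

/-- The filtration generated by the dyadic cubes. -/
noncomputable def dyadicFiltration (d : ℕ) :
    Filtration ℕ (inferInstance : MeasurableSpace (EuclideanSpace ℝ (Fin d))) where
  seq j := MeasurableSpace.comap (dyadicIndex j) inferInstance
  mono' := by
    refine monotone_nat_of_le_succ fun j => ?_
    rw [← measurable_iff_comap_le]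
    have : dyadicIndex (d := d) j = (fun k l => k l / 2) ∘ dyadicIndex (j + 1) :=
      funext fun x => dyadicIndex_eq_of_succ j x
    rw [this]
    exact Measurable.of_discrete.comp (comap_measurable _)
  le' j := (measurable_dyadicIndex j).comap_le

lemma measurable_comp_dyadicIndex {β : Type*} [MeasurableSpace β] (j : ℕ) (f : (Fin d → ℤ) → β) :
    Measurable[dyadicFiltration d j] fun x => f (dyadicIndex j x) :=
  (Measurable.of_discrete (f := f)).comp (comap_measurable (dyadicIndex j))

/-- A function measurable at level j is a function of the cube index, so both integrals become sums
over the cubes and can be compared cube by cube. -/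
lemma isThick_dyadicFiltration {ν : Measure (EuclideanSpace ℝ (Fin d))}
    {E : ℕ → (Fin d → ℤ) → Set (EuclideanSpace ℝ (Fin d))} {C : ℝ≥0∞}
    (hEm : ∀ j k, MeasurableSet (E j k)) (hEs : ∀ j k, E j k ⊆ dyadicCube j k)
    (hE : ∀ j k, ν (dyadicCube j k) ≤ C * ν (E j k)) :
    IsThick ν (dyadicFiltration d) (fun j => ⋃ k, E j k) C := by
  refine ⟨fun j => MeasurableSet.iUnion (hEm j), fun j H hH => ?_⟩
  have hH' : Measurable[MeasurableSpace.comap (dyadicIndex j) inferInstance] H := hH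
  obtain ⟨h, -, rfl⟩ := hH'.exists_eq_measurable_comp
  have hm : Measurable h := Measurable.of_discrete
  simp only [Function.comp_apply]
  rw [← lintegral_map hm (measurable_dyadicIndex j), ← lintegral_map hm (measurable_dyadicIndex j),
    lintegral_countable', lintegral_countable', ← ENNReal.tsum_mul_left]
  refine ENNReal.tsum_le_tsum fun k => ?_
  rw [Measure.map_apply (measurable_dyadicIndex j) (measurableSet_singleton k),
    Measure.map_apply (measurable_dyadicIndex j) (measurableSet_singleton k),
    preimage_dyadicIndex, Measure.restrict_apply (measurableSet_dyadicCube j k), mul_left_comm]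
  gcongr
  refine (hE j k).trans ?_
  gcongr
  exact Set.subset_inter (hEs j k) (Set.subset_iUnion _ k)

/-- The coefficient `2^(js) |a_{j,k}|`. -/
noncomputable def dyadicCoeff (s : ℝ) (a : ℕ × (Fin d → ℤ) → ℂ) (j : ℕ) (k : Fin d → ℤ) : ℝ≥0 :=
  ((2 : ℝ) ^ (s * (j : ℝ)) * ‖a (j, k)‖).toNNReal

lemma dyadicTerm_of_eq (s : ℝ) (a : ℕ × (Fin d → ℤ) → ℂ) (j : ℕ)
    (x : EuclideanSpace ℝ (Fin d)) :
    dyadicTerm s a j (dyadicIndex j x) x = dyadicCoeff s a j (dyadicIndex j x) := by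
  rw [dyadicTerm, Set.indicator_of_mem (mem_dyadicCube_iff.2 rfl)]
  rfl

lemma dyadicTerm_of_ne (s : ℝ) (a : ℕ × (Fin d → ℤ) → ℂ) (j : ℕ) {k : Fin d → ℤ}
    {x : EuclideanSpace ℝ (Fin d)} (hk : k ≠ dyadicIndex j x) :
    dyadicTerm s a j k x = 0 := by
  rw [dyadicTerm, Set.indicator_of_notMem fun h => hk (mem_dyadicCube_iff.1 h).symm]

/-- Exactly one cube of each level contains x, so the sum or supremum over k has a single relevant
term. -/
lemma dyadicSquareFunction_eq (s : ℝ) {q : ℝ≥0∞} (hq : 0 < q) (a : ℕ × (Fin d → ℤ) → ℂ)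
    (x : EuclideanSpace ℝ (Fin d)) :
    dyadicSquareFunction s q a x =
      sequenceNorm q fun j => (dyadicCoeff s a j (dyadicIndex j x) : ℝ≥0∞) := by
  unfold dyadicSquareFunction sequenceNorm
  split_ifs with hqt
  · refine iSup_congr fun j => le_antisymm (iSup_le fun k => ?_) ?_
    · by_cases hk : k = dyadicIndex j x
      · rw [hk, dyadicTerm_of_eq]
      · rw [dyadicTerm_of_ne s a j hk]; exact zero_le
    · rw [← dyadicTerm_of_eq]
      exact le_iSup (fun k => dyadicTerm s a j k x) _
  · have hq' : 0 < q.toReal := ENNReal.toReal_pos hq.ne' hqt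
    congr 1
    refine tsum_congr fun j => ?_
    rw [tsum_eq_single (dyadicIndex j x), dyadicTerm_of_eq]
    intro k hk
    rw [dyadicTerm_of_ne s a j hk, ENNReal.zero_rpow_of_pos hq']

lemma measurable_sequenceNorm {X : Type*} [MeasurableSpace X] {q : ℝ≥0∞} {b : ℕ → X → ℝ≥0∞}
    (hb : ∀ j, Measurable (b j)) : Measurable fun x => sequenceNorm q fun j => b j x := by
  unfold sequenceNorm
  split_ifs
  · exact Measurable.iSup hb
  · exact (Measurable.tsum fun j => (hb j).pow_const _).pow_const _

lemma measurable_dyadicSquareFunction (s : ℝ) {q : ℝ≥0∞} (hq : 0 < q)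
    (a : ℕ × (Fin d → ℤ) → ℂ) : Measurable (dyadicSquareFunction s q a) := by
  simp only [funext fun x => dyadicSquareFunction_eq s hq a x]
  refine measurable_sequenceNorm fun j => ?_
  exact (Measurable.of_discrete (f := fun k => (dyadicCoeff s a j k : ℝ≥0∞))).comp
    (measurable_dyadicIndex j)

lemma dyadicCoeff_le_dyadicSquareFunction (s : ℝ) {q : ℝ≥0∞} (hq : 0 < q)
    (a : ℕ × (Fin d → ℤ) → ℂ) (j : ℕ) (x : EuclideanSpace ℝ (Fin d)) :
    (dyadicCoeff s a j (dyadicIndex j x) : ℝ≥0∞) ≤ dyadicSquareFunction s q a x := by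
  rw [dyadicSquareFunction_eq s hq, sequenceNorm]
  split_ifs with hqt
  · exact le_iSup (fun j => (dyadicCoeff s a j (dyadicIndex j x) : ℝ≥0∞)) j
  · have hq' : 0 < q.toReal := ENNReal.toReal_pos hq.ne' hqt
    rw [one_div, ENNReal.le_rpow_inv_iff hq']
    exact ENNReal.le_tsum (f := fun j => (dyadicCoeff s a j (dyadicIndex j x) : ℝ≥0∞) ^ q.toReal) j

/-- A half-open cube with the lower left corner `v` and the side length `r`. -/
def halfOpenCube (v : Fin d → ℝ) (r : ℝ) : Set (EuclideanSpace ℝ (Fin d)) :=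
  {x | ∀ l, v l ≤ x l ∧ x l < v l + r}

lemma dyadicCube_eq_halfOpenCube (j : ℕ) (k : Fin d → ℤ) :
    dyadicCube j k =
      halfOpenCube (fun l => (2 : ℝ) ^ (-(j : ℤ)) * (k l : ℝ)) ((2 : ℝ) ^ (-(j : ℤ))) := by
  simp only [dyadicCube, halfOpenCube, mul_add, mul_one]

lemma measurableSet_halfOpenCube (v : Fin d → ℝ) (r : ℝ) : MeasurableSet (halfOpenCube v r) := by
  have : halfOpenCube v r = ⋂ l, (fun x : EuclideanSpace ℝ (Fin d) => x l) ⁻¹'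
      Set.Ico (v l) (v l + r) := by
    ext x; simp [halfOpenCube]
  rw [this]
  refine MeasurableSet.iInter fun l => ?_
  have : Measurable fun x : EuclideanSpace ℝ (Fin d) => x l := by fun_prop
  exact this measurableSet_Ico

lemma volume_halfOpenCube (v : Fin d → ℝ) (r : ℝ) :
    volume (halfOpenCube v r) = ENNReal.ofReal r ^ d := by
  have : halfOpenCube v r = WithLp.ofLp ⁻¹' (Set.univ.pi fun l => Set.Ico (v l) (v l + r)) := by
    ext x; simp [halfOpenCube]
  rw [this, (PiLp.volume_preserving_ofLp (Fin d)).measure_preimage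
    (MeasurableSet.univ_pi fun _ => measurableSet_Ico).nullMeasurableSet, Real.volume_pi_Ico]
  simp

end Dyadic

/-! ### Local Muckenhoupt weights on cubes -/

section Muckenhoupt

variable {d : ℕ}

/-- On the cubes of side length at most `L`, sets of a fixed Lebesgue proportion carry a fixed
proportion of `ν`. -/
def CubeComparable (ν : Measure (EuclideanSpace ℝ (Fin d))) (L : ℝ) : Prop :=
  ∀ η : ℝ≥0∞, η ≠ 0 → ∃ C : ℝ≥0∞, C ≠ ∞ ∧ ∀ (v : Fin d → ℝ) (r : ℝ)
    (E : Set (EuclideanSpace ℝ (Fin d))), 0 < r → r ≤ L → MeasurableSet E →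
    E ⊆ halfOpenCube v r → η * volume (halfOpenCube v r) ≤ volume E →
    ν (halfOpenCube v r) ≤ C * ν E

lemma CubeComparable.mono {ν : Measure (EuclideanSpace ℝ (Fin d))} {L L' : ℝ}
    (h : CubeComparable ν L) (hL : L' ≤ L) : CubeComparable ν L' := by
  intro η hη
  obtain ⟨C, hC, h⟩ := h η hη
  exact ⟨C, hC, fun v r E hr hrL => h v r E hr (hrL.trans hL)⟩

/-- The cube is covered by 2^d subcubes of side 2r/3 which all contain the central cube `K` of side
r/3. One of them, `R σ`, meets `E` in a large set; its ν-measure controls that of `K`, which in turn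
controls all the others. -/
lemma CubeComparable.three_halves {ν : Measure (EuclideanSpace ℝ (Fin d))} {L : ℝ}
    (h : CubeComparable ν L) : CubeComparable ν (3 / 2 * L) := by
  intro η hη
  obtain ⟨C₁, hC₁, h₁⟩ := h (((2 : ℝ≥0∞) ^ d)⁻¹ * η) (by simp [hη])
  obtain ⟨C₂, hC₂, h₂⟩ := h (((2 : ℝ≥0∞) ^ d)⁻¹) (by simp)
  refine ⟨2 ^ d * (C₂ * C₁), ENNReal.mul_ne_top (by simp) (ENNReal.mul_ne_top hC₂ hC₁), ?_⟩
  intro v r E hr hrL hEm hE hvol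
  set R : (Fin d → Bool) → Set (EuclideanSpace ℝ (Fin d)) := fun σ =>
    halfOpenCube (fun l => v l + if σ l then r / 3 else 0) (2 / 3 * r) with hR
  set K : Set (EuclideanSpace ℝ (Fin d)) := halfOpenCube (fun l => v l + r / 3) (r / 3) with hK
  have hr' : 2 / 3 * r ≤ L := by linarith
  have hcover : halfOpenCube v r ⊆ ⋃ σ, R σ := by
    intro x hx
    refine Set.mem_iUnion.2 ⟨fun l => decide (v l + r / 3 ≤ x l), fun l => ?_⟩
    have := hx l
    simp only [decide_eq_true_eq]
    split_ifs with hl <;> constructor <;> linarith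
  have hRQ : ∀ σ, R σ ⊆ halfOpenCube v r := by
    intro σ x hx l
    have := hx l
    dsimp only at this
    split_ifs at this <;> constructor <;> linarith
  have hKR : ∀ σ, K ⊆ R σ := by
    intro σ x hx l
    have := hx l
    dsimp only at this ⊢
    split_ifs <;> constructor <;> linarith
  have hcard : (Finset.univ : Finset (Fin d → Bool)).card = 2 ^ d := by simp
  -- Pigeonhole: otherwise the 2^d pieces of `E` would have total volume below η |Q|.
  obtain ⟨σ, hσ⟩ : ∃ σ, ((2 : ℝ≥0∞) ^ d)⁻¹ * η * volume (R σ) ≤ volume (E ∩ R σ) := by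
    by_contra! hcon
    have h1 : ∑ σ, volume (E ∩ R σ) < ∑ _σ : Fin d → Bool,
        ((2 : ℝ≥0∞) ^ d)⁻¹ * η * volume (halfOpenCube v r) := by
      refine ENNReal.sum_lt_sum_of_nonempty Finset.univ_nonempty fun σ _ => ?_
      refine (hcon σ).trans_le ?_
      gcongr
      exact hRQ σ
    rw [Finset.sum_const, hcard, nsmul_eq_mul, Nat.cast_pow, Nat.cast_ofNat, ← mul_assoc,
      ← mul_assoc, ENNReal.mul_inv_cancel (by simp) (by simp), one_mul] at h1
    refine absurd (hvol.trans ?_) (not_le.2 h1)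
    calc volume E ≤ volume (⋃ σ, E ∩ R σ) := by
          refine measure_mono fun x hx => ?_
          obtain ⟨σ, hσ⟩ := Set.mem_iUnion.1 (hcover (hE hx))
          exact Set.mem_iUnion.2 ⟨σ, hx, hσ⟩
      _ ≤ _ := measure_iUnion_fintype_le _ _
  have hσE : ν (R σ) ≤ C₁ * ν E := by
    refine (h₁ _ _ (E ∩ R σ) (by positivity) hr'
      (hEm.inter (measurableSet_halfOpenCube _ _)) Set.inter_subset_right hσ).trans ?_
    gcongr
    exact Set.inter_subset_left
  have hτ : ∀ τ, ν (R τ) ≤ C₂ * (C₁ * ν E) := by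
    intro τ
    refine (h₂ _ _ K (by positivity) hr' (measurableSet_halfOpenCube _ _) (hKR τ) ?_).trans ?_
    · rw [volume_halfOpenCube, volume_halfOpenCube, ENNReal.inv_pow, ← mul_pow]
      gcongr
      rw [show 2 / 3 * r = 2 * (r / 3) by ring, ENNReal.ofReal_mul zero_le_two, ← mul_assoc]
      simp [ENNReal.inv_mul_cancel]
    · gcongr
      exact (measure_mono (hKR σ)).trans hσE
  calc ν (halfOpenCube v r) ≤ ∑ τ, ν (R τ) :=
        (measure_mono hcover).trans (measure_iUnion_fintype_le _ _)
    _ ≤ ∑ _τ : Fin d → Bool, C₂ * (C₁ * ν E) := Finset.sum_le_sum fun τ _ => hτ τ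
    _ = _ := by
      rw [Finset.sum_const, hcard, nsmul_eq_mul]
      push_cast
      ring

lemma CubeComparable.of_pos {ν : Measure (EuclideanSpace ℝ (Fin d))} {L : ℝ} (hL : 0 < L)
    (h : CubeComparable ν L) (L' : ℝ) : CubeComparable ν L' := by
  have hn : ∀ n : ℕ, CubeComparable ν ((3 / 2) ^ n * L) := by
    intro n
    induction n with
    | zero => simpa using h
    | succ n ih => rw [pow_succ', mul_assoc]; exact ih.three_halves
  obtain ⟨n, hn'⟩ := pow_unbounded_of_one_lt (L' / L) (by norm_num : (1 : ℝ) < 3 / 2)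
  exact (hn n).mono ((div_lt_iff₀ hL).1 hn').le

variable {w : EuclideanSpace ℝ (Fin d) → ℝ}

lemma IsLocalMuckenhoupt.aemeasurable {r : ℝ} (hw : IsLocalMuckenhoupt r w) :
    AEMeasurable (fun x => ENNReal.ofReal (w x)) volume :=
  hw.2.1.aestronglyMeasurable.aemeasurable.ennreal_ofReal

lemma exists_pos_volume_ball_le_one (hd : 1 ≤ d) :
    ∃ L : ℝ, 0 < L ∧ ∀ (c : EuclideanSpace ℝ (Fin d)) (r : ℝ), r ≤ L →
      volume (Metric.ball c r) ≤ 1 := by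
  have : Nonempty (Fin d) := ⟨⟨0, hd⟩⟩
  set k := volume (Metric.ball (0 : EuclideanSpace ℝ (Fin d)) 1) with hk
  have hk0 : k ≠ 0 := (Metric.measure_ball_pos _ _ one_pos).ne'
  have hkt : k ≠ ∞ := measure_ball_lt_top.ne
  have hkp := ENNReal.toReal_pos hk0 hkt
  obtain ⟨L, hL0, hL1, hLk⟩ : ∃ L : ℝ, 0 < L ∧ L ≤ 1 ∧ L ≤ 1 / k.toReal :=
    ⟨min 1 (1 / k.toReal), by positivity, min_le_left _ _, min_le_right _ _⟩
  refine ⟨L, hL0, fun c r hr => (measure_mono (Metric.ball_subset_ball hr)).trans ?_⟩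
  rw [Measure.addHaar_ball _ _ hL0.le, ← hk, ← ENNReal.ofReal_toReal hkt,
    ← ENNReal.ofReal_mul (by positivity), ENNReal.ofReal_le_one, ← le_div_iff₀ hkp]
  refine (pow_le_of_le_one hL0.le hL1 ?_).trans hLk
  simp; omega

/-- The dual weight is ∞ wherever w vanishes, so finite dual averages over small balls make the zero
set locally null. -/
lemma IsLocalMuckenhoupt.ae_pos (hd : 1 ≤ d) {r : ℝ} (hr : 1 < r) (hw : IsLocalMuckenhoupt r w) :
    ∀ᵐ x, 0 < w x := by
  obtain ⟨L, hL, hball⟩ := exists_pos_volume_ball_le_one hd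
  obtain ⟨C, hC, hw3⟩ := hw.2.2
  have hrc := Real.HolderConjugate.conjExponent hr
  rw [ae_iff]
  refine measure_null_of_locally_null _ fun c _ => ?_
  refine ⟨Metric.ball c L ∩ {x | ¬ 0 < w x},
    Filter.inter_mem (mem_nhdsWithin_of_mem_nhds (Metric.ball_mem_nhds c hL)) self_mem_nhdsWithin, ?_⟩
  have h := (hw3 c L hL (hball c L le_rfl)).1
  rw [setLAverage_eq] at h
  have hfin : ∫⁻ x in Metric.ball c L, ENNReal.ofReal (w x) ^ (-(r.conjExponent / r)) ≠ ∞ :=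
    fun ht => h (by rw [ht, ENNReal.top_div_of_ne_top measure_ball_lt_top.ne])
  have hae := ae_lt_top' (hw.aemeasurable.pow_const _).restrict hfin
  rw [ae_restrict_iff' measurableSet_ball, ae_iff] at hae
  refine measure_mono_null ?_ hae
  intro x hx hlt
  have h0 : ENNReal.ofReal (w x) = 0 := ENNReal.ofReal_of_nonpos (not_lt.1 hx.2)
  have hneg : -(r.conjExponent / r) < 0 :=
    neg_lt_zero.2 (div_pos hrc.symm.pos (by linarith))
  exact (hlt hx.1).ne (by rw [h0, ENNReal.zero_rpow_of_neg hneg])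

/-- Hölder's inequality for 1 = w^(1/r) w^(-1/r) on `E`, with the dual integral enlarged to the ball
and then bounded by the Muckenhoupt condition. -/
lemma IsLocalMuckenhoupt.exists_lintegral_ball_le (hd : 1 ≤ d) {r : ℝ} (hr : 1 < r)
    (hw : IsLocalMuckenhoupt r w) :
    ∃ C : ℝ≥0∞, C ≠ ∞ ∧ ∀ (c : EuclideanSpace ℝ (Fin d)) (ρ : ℝ), 0 < ρ →
      volume (Metric.ball c ρ) ≤ 1 → ∀ E ⊆ Metric.ball c ρ,
      volume E ^ r * ∫⁻ x in Metric.ball c ρ, ENNReal.ofReal (w x) ≤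
        C * volume (Metric.ball c ρ) ^ r * ∫⁻ x in E, ENNReal.ofReal (w x) := by
  obtain ⟨C, hC, hw3⟩ := hw.2.2
  have hr0 : 0 < r := by linarith
  have hrc := Real.HolderConjugate.conjExponent hr
  have hr'0 : 0 < r.conjExponent := hrc.symm.pos
  refine ⟨C ^ r, ENNReal.rpow_ne_top_of_nonneg hr0.le hC, fun c ρ hρ hball E hE => ?_⟩
  obtain ⟨-, h⟩ := hw3 c ρ hρ hball
  set W : EuclideanSpace ℝ (Fin d) → ℝ≥0∞ := fun x => ENNReal.ofReal (w x) with hW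
  set V := volume (Metric.ball c ρ) with hV
  have hV0 : V ≠ 0 := (Metric.measure_ball_pos _ _ hρ).ne'
  have hVt : V ≠ ∞ := measure_ball_lt_top.ne
  rw [setLAverage_eq, setLAverage_eq] at h
  set A := ∫⁻ x in Metric.ball c ρ, W x with hA
  set D := ∫⁻ x in Metric.ball c ρ, W x ^ (-(r.conjExponent / r)) with hD
  set N := ∫⁻ x in E, W x with hN
  have hWm : AEMeasurable W volume := hw.aemeasurable
  have hE1 : volume E ≤ N ^ (1 / r) * D ^ (1 / r.conjExponent) := by
    calc volume E = ∫⁻ x in E, 1 := by simp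
      _ = ∫⁻ x in E, W x ^ (1 / r) * (W x ^ (-(r.conjExponent / r))) ^ (1 / r.conjExponent) := by
        refine lintegral_congr_ae ((ae_restrict_of_ae (hw.ae_pos hd hr)).mono fun x hx => ?_)
        have hx0 : W x ≠ 0 := by simpa [hW] using hx
        have hxt : W x ≠ ∞ := ENNReal.ofReal_ne_top
        dsimp only
        rw [← ENNReal.rpow_mul, ← ENNReal.rpow_add _ _ hx0 hxt]
        have : 1 / r + -(r.conjExponent / r) * (1 / r.conjExponent) = 0 := by
          field_simp; ring
        rw [this, ENNReal.rpow_zero]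
      _ ≤ N ^ (1 / r) * (∫⁻ x in E, W x ^ (-(r.conjExponent / r))) ^ (1 / r.conjExponent) :=
        ENNReal.lintegral_mul_norm_pow_le hWm.restrict (hWm.pow_const _).restrict
          (by positivity) (by positivity) (by simpa using hrc.inv_add_inv_eq_one)
      _ ≤ _ := by
        gcongr
        exact lintegral_mono_set hE
  have hAV : A ^ (1 / r) = (A / V) ^ (1 / r) * V ^ (1 / r) := by
    rw [← ENNReal.mul_rpow_of_nonneg _ _ (by positivity), ENNReal.div_mul_cancel hV0 hVt]
  have hDV : D ^ (1 / r.conjExponent) =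
      (D / V) ^ (1 / r.conjExponent) * V ^ (1 / r.conjExponent) := by
    rw [← ENNReal.mul_rpow_of_nonneg _ _ (by positivity), ENNReal.div_mul_cancel hV0 hVt]
  have key : volume E * A ^ (1 / r) ≤ C * V * N ^ (1 / r) := by
    calc volume E * A ^ (1 / r)
        ≤ N ^ (1 / r) * D ^ (1 / r.conjExponent) * A ^ (1 / r) := by gcongr
      _ = ((A / V) ^ (1 / r) * (D / V) ^ (1 / r.conjExponent)) *
            (V ^ (1 / r) * V ^ (1 / r.conjExponent)) * N ^ (1 / r) := by rw [hAV, hDV]; ring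
      _ ≤ C * (V ^ (1 / r) * V ^ (1 / r.conjExponent)) * N ^ (1 / r) := by gcongr
      _ = _ := by
        rw [← ENNReal.rpow_add _ _ hV0 hVt]
        have : 1 / r + 1 / r.conjExponent = 1 := by simpa using hrc.inv_add_inv_eq_one
        rw [this, ENNReal.rpow_one]
  have := ENNReal.rpow_le_rpow key hr0.le
  rw [ENNReal.mul_rpow_of_nonneg _ _ hr0.le, ENNReal.mul_rpow_of_nonneg _ _ hr0.le,
    ENNReal.mul_rpow_of_nonneg _ _ hr0.le, ← ENNReal.rpow_mul, ← ENNReal.rpow_mul,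
    one_div_mul_cancel hr0.ne', ENNReal.rpow_one, ENNReal.rpow_one] at this
  exact this

lemma halfOpenCube_subset_ball (v : Fin d → ℝ) {r : ℝ} (hr : 0 < r) :
    halfOpenCube v r ⊆ Metric.ball (WithLp.toLp 2 v) ((d + 1) * r) := by
  intro x hx
  rw [Metric.mem_ball, EuclideanSpace.dist_eq, Real.sqrt_lt' (by positivity)]
  calc ∑ l, dist (x l) ((WithLp.toLp 2 v : EuclideanSpace ℝ (Fin d)) l) ^ 2
      ≤ ∑ _l : Fin d, r ^ 2 := by
        refine Finset.sum_le_sum fun l _ => ?_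
        have := hx l
        rw [Real.dist_eq, sq_abs]
        refine pow_le_pow_left₀ ?_ ?_ 2
        · simpa using this.1
        · simp only; linarith
    _ = d * r ^ 2 := by simp
    _ < _ := by
      rw [mul_pow]
      gcongr
      nlinarith [(Nat.cast_nonneg d : (0 : ℝ) ≤ d)]

/-- A small cube lies in a ball of comparable volume, with ratio κ, to which the previous estimate
applies. `CubeComparable.of_pos` then removes the restriction to small cubes. -/
lemma IsLocalMuckenhoupt.cubeComparable (hd : 1 ≤ d) {r : ℝ} (hr : 1 < r)
    (hw : IsLocalMuckenhoupt r w) (L : ℝ) :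
    CubeComparable (volume.withDensity fun x => ENNReal.ofReal (w x)) L := by
  have : Nonempty (Fin d) := ⟨⟨0, hd⟩⟩
  have hr0 : 0 < r := by linarith
  obtain ⟨L₀, hL₀, hball⟩ := exists_pos_volume_ball_le_one hd
  obtain ⟨C, hC, h⟩ := hw.exists_lintegral_ball_le hd hr
  refine CubeComparable.of_pos (L := L₀ / (d + 1)) (by positivity) ?_ L
  intro η hη
  set κ : ℝ≥0∞ := ENNReal.ofReal ((d + 1 : ℝ) ^ d) *
    volume (Metric.ball (0 : EuclideanSpace ℝ (Fin d)) 1) with hκ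
  have hκt : κ ≠ ∞ := ENNReal.mul_ne_top ENNReal.ofReal_ne_top measure_ball_lt_top.ne
  refine ⟨C * (κ / η) ^ r, ENNReal.mul_ne_top hC (ENNReal.rpow_ne_top_of_nonneg hr0.le
    (ENNReal.div_ne_top hκt hη)), fun v t E ht htL hEm hE hvol => ?_⟩
  set B : Set (EuclideanSpace ℝ (Fin d)) := Metric.ball (WithLp.toLp 2 v) ((d + 1) * t) with hB
  have hQB : halfOpenCube v t ⊆ B := halfOpenCube_subset_ball v ht
  have hVB : volume B = κ * volume (halfOpenCube v t) := by
    rw [hB, Measure.addHaar_ball _ _ (by positivity), volume_halfOpenCube, finrank_euclideanSpace,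
      Fintype.card_fin, mul_pow, ENNReal.ofReal_mul (by positivity), hκ,
      ENNReal.ofReal_pow ht.le]
    ring
  have hQ0 : volume (halfOpenCube v t) ≠ 0 := by
    rw [volume_halfOpenCube]; simp [ht]
  have hQt : volume (halfOpenCube v t) ≠ ∞ := by
    rw [volume_halfOpenCube]; simp
  have hle := h (WithLp.toLp 2 v) ((d + 1) * t) (by positivity)
    (hball _ _ (by rwa [le_div_iff₀ (by positivity), mul_comm] at htL)) E (hE.trans hQB)
  rw [withDensity_apply _ (measurableSet_halfOpenCube v t), withDensity_apply _ hEm]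
  set A := ∫⁻ x in halfOpenCube v t, ENNReal.ofReal (w x)
  set N := ∫⁻ x in E, ENNReal.ofReal (w x)
  set Q := volume (halfOpenCube v t)
  have hηt : η ≠ ∞ := by
    rintro rfl
    rw [ENNReal.top_mul hQ0, top_le_iff] at hvol
    exact hQt (top_le_iff.1 (hvol ▸ measure_mono hE))
  have hηr : η ^ r ≠ 0 := by simp [hη, hr0.le]
  have hηrt : η ^ r ≠ ∞ := ENNReal.rpow_ne_top_of_nonneg hr0.le hηt
  have hQr : Q ^ r ≠ 0 := by simp [hQ0, hr0.le]
  have hQrt : Q ^ r ≠ ∞ := ENNReal.rpow_ne_top_of_nonneg hr0.le hQt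
  have h1 : Q ^ r * (η ^ r * A) ≤ Q ^ r * (C * κ ^ r * N) := by
    calc Q ^ r * (η ^ r * A) = (η * Q) ^ r * A := by
          rw [ENNReal.mul_rpow_of_nonneg _ _ hr0.le]; ring
      _ ≤ volume E ^ r * ∫⁻ x : EuclideanSpace ℝ (Fin d) in B, ENNReal.ofReal (w x) := by
          gcongr
          exact lintegral_mono_set hQB
      _ ≤ C * volume B ^ r * N := hle
      _ = Q ^ r * (C * κ ^ r * N) := by
          rw [hVB, ENNReal.mul_rpow_of_nonneg _ _ hr0.le]; ring
  rw [ENNReal.mul_le_mul_iff_right hQr hQrt] at h1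
  rw [ENNReal.div_rpow_of_nonneg _ _ hr0.le, ENNReal.div_eq_inv_mul]
  calc A = (η ^ r)⁻¹ * (η ^ r * A) := by
        rw [← mul_assoc, ENNReal.inv_mul_cancel hηr hηrt, one_mul]
    _ ≤ (η ^ r)⁻¹ * (C * κ ^ r * N) := by gcongr
    _ = _ := by ring

end Muckenhoupt

/-! ### Medians -/

/-- The median is the supremum of the levels t with μ(Q ∩ {u < t}) ≤ μ(Q)/2; continuity of μ from
below and from above gives the two bounds. -/
lemma exists_median {X : Type*} [MeasurableSpace X] {μ : Measure X} {Q : Set X}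
    (hQ : MeasurableSet Q) (hμQ : μ Q ≠ ∞) {u : X → ℝ≥0∞} (hu : Measurable u) :
    ∃ m : ℝ≥0∞, 2⁻¹ * μ Q ≤ μ (Q ∩ {x | m ≤ u x}) ∧ 2⁻¹ * μ Q ≤ μ (Q ∩ {x | u x ≤ m}) := by
  set S : Set ℝ≥0∞ := {t | μ (Q ∩ {x | u x < t}) ≤ 2⁻¹ * μ Q} with hS
  have hSlt : ∀ t < sSup S, μ (Q ∩ {x | u x < t}) ≤ 2⁻¹ * μ Q := by
    intro t ht
    obtain ⟨s, hs, hts⟩ := lt_sSup_iff.1 ht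
    refine le_trans (measure_mono ?_) hs
    exact Set.inter_subset_inter_right _ fun x hx => lt_trans hx hts
  have hhalf : 2⁻¹ * μ Q + 2⁻¹ * μ Q = μ Q := by
    rw [← add_mul, ENNReal.inv_two_add_inv_two, one_mul]
  refine ⟨sSup S, ?_, ?_⟩
  · have hlow : μ (Q ∩ {x | u x < sSup S}) ≤ 2⁻¹ * μ Q := by
      rcases eq_or_ne (sSup S) 0 with h0 | h0
      · simp [h0]
      obtain ⟨t, htm, htlt, htlim⟩ := exists_seq_strictMono_tendsto' (pos_iff_ne_zero.2 h0)
      have hU : Q ∩ {x | u x < sSup S} = ⋃ n, Q ∩ {x | u x < t n} := by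
        rw [← Set.inter_iUnion]
        congr 1
        ext x
        simp only [Set.mem_iUnion]
        constructor
        · intro hx
          exact (htlim.eventually (lt_mem_nhds hx)).exists
        · rintro ⟨n, hn⟩
          exact lt_trans hn (htlt n).2
      have hmono : Monotone fun n => Q ∩ {x | u x < t n} := by
        intro m n h x hx
        exact ⟨hx.1, lt_of_lt_of_le hx.2 (htm.monotone h)⟩
      rw [hU, hmono.measure_iUnion]
      exact iSup_le fun n => hSlt _ (htlt n).2
    have hadd := measure_inter_add_sdiff (μ := μ) Q (measurableSet_lt hu measurable_const :
      MeasurableSet {x | u x < sSup S})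
    have hdiff : Q \ {x | u x < sSup S} = Q ∩ {x | sSup S ≤ u x} := by
      ext x; simp
    rw [hdiff] at hadd
    by_contra! hcon
    have : μ Q < μ Q := by
      calc μ Q = _ := hadd.symm
        _ < 2⁻¹ * μ Q + 2⁻¹ * μ Q :=
          ENNReal.add_lt_add_of_le_of_lt (ne_top_of_le_ne_top hμQ
            (measure_mono Set.inter_subset_left)) hlow hcon
        _ = μ Q := hhalf
    exact this.false
  · rcases eq_or_ne (sSup S) ∞ with ht | ht
    · have : Q ∩ {x | u x ≤ sSup S} = Q := by ext x; simp [ht]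
      rw [this]
      exact le_self_add.trans_eq hhalf
    obtain ⟨t, htm, htlt, htlim⟩ := exists_seq_strictAnti_tendsto' (lt_top_iff_ne_top.2 ht)
    have hI : Q ∩ {x | u x ≤ sSup S} = ⋂ n, Q ∩ {x | u x < t n} := by
      rw [← Set.inter_iInter]
      congr 1
      ext x
      simp only [Set.mem_iInter]
      constructor
      · intro hx n
        exact lt_of_le_of_lt hx (htlt n).1
      · intro hx
        exact ge_of_tendsto' htlim fun n => (hx n).le
    have hanti : Antitone fun n => Q ∩ {x | u x < t n} := by
      intro m n h x hx
      exact ⟨hx.1, lt_of_lt_of_le hx.2 (htm.antitone h)⟩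
    rw [hI, hanti.measure_iInter
      (fun n => (hQ.inter (measurableSet_lt hu measurable_const)).nullMeasurableSet)
      ⟨0, ne_top_of_le_ne_top hμQ (measure_mono Set.inter_subset_left)⟩]
    refine le_iInf fun n => ?_
    by_contra! hcon
    exact absurd (le_sSup (show t n ∈ S from hcon.le)) (not_le.2 (htlt n).1)

/-- Both half-sets have positive measure, so each contains a point where u is neither 0 nor ∞, and
these points bound the median from both sides. -/
lemma exists_median_of_ae {X : Type*} [MeasurableSpace X] {μ : Measure X} {Q : Set X}
    (hQ : MeasurableSet Q) (hμQ : μ Q ≠ ∞) (hμ0 : μ Q ≠ 0) {u : X → ℝ≥0∞} (hu : Measurable u)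
    (hae : ∀ᵐ x ∂μ, x ∈ Q → u x ≠ 0 ∧ u x ≠ ∞) :
    ∃ m : ℝ≥0, m ≠ 0 ∧ 2⁻¹ * μ Q ≤ μ (Q ∩ {x | (m : ℝ≥0∞) ≤ u x}) ∧
      2⁻¹ * μ Q ≤ μ (Q ∩ {x | u x ≤ m}) := by
  obtain ⟨m, h1, h2⟩ := exists_median hQ hμQ hu
  have hpos : (2⁻¹ : ℝ≥0∞) * μ Q ≠ 0 := by simp [hμ0]
  have hex : ∀ s : Set X, 2⁻¹ * μ Q ≤ μ (Q ∩ s) → ∃ x ∈ s, u x ≠ 0 ∧ u x ≠ ∞ := by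
    intro s hs
    by_contra! hcon
    refine hpos (le_antisymm (hs.trans (le_of_eq ?_)) zero_le)
    refine measure_mono_null ?_ (ae_iff.1 hae)
    intro x hx hx'
    exact (hx' hx.1).2 (hcon x hx.2 (hx' hx.1).1)
  obtain ⟨x, hx, -, hxt⟩ := hex _ h1
  obtain ⟨y, hy, hy0, -⟩ := hex _ h2
  have hmt : m ≠ ∞ := ne_top_of_le_ne_top hxt hx
  have hm0 : m ≠ 0 := fun h => hy0 (le_antisymm (hy.trans_eq h) zero_le)
  lift m to ℝ≥0 using hmt
  exact ⟨m, by simpa using hm0, h1, h2⟩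

/-! ### Sequence norms -/

lemma sequenceNorm_zero {q : ℝ≥0∞} (hq : 0 < q) : sequenceNorm q (fun _ => 0) = 0 := by
  unfold sequenceNorm
  split_ifs with hqt
  · simp
  · have hq' : 0 < q.toReal := ENNReal.toReal_pos hq.ne' hqt
    simp [ENNReal.zero_rpow_of_pos hq', hq']

lemma ENNReal.tsum_mul_rpow_le (f g : ℕ → ℝ≥0∞) {p q : ℝ} (hp : 0 ≤ p) (hq : 0 ≤ q)
    (hpq : p + q = 1) : ∑' j, f j ^ p * g j ^ q ≤ (∑' j, f j) ^ p * (∑' j, g j) ^ q := by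
  have := ENNReal.lintegral_mul_norm_pow_le (μ := Measure.count) (f := f) (g := g)
    Measurable.of_discrete.aemeasurable Measurable.of_discrete.aemeasurable hp hq hpq
  simpa only [lintegral_count] using this

/-- Hölder's inequality for sequence norms. -/
lemma sequenceNorm_mul_rpow_le {q₀ q₁ q : ℝ≥0∞} (hq₀ : 0 < q₀) (hq₁ : 0 < q₁) (hq : 0 < q)
    {Θ : ℝ} (hΘ₀ : 0 < Θ) (hΘ₁ : Θ < 1) (hqt : q = ∞ ↔ q₀ = ∞ ∧ q₁ = ∞)
    (hqr : 1 / q.toReal = (1 - Θ) / q₀.toReal + Θ / q₁.toReal) (b₀ b₁ : ℕ → ℝ≥0∞) :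
    sequenceNorm q (fun j => b₀ j ^ (1 - Θ) * b₁ j ^ Θ) ≤
      sequenceNorm q₀ b₀ ^ (1 - Θ) * sequenceNorm q₁ b₁ ^ Θ := by
  have hΘ₁' : 0 < 1 - Θ := by linarith
  by_cases h : q = ∞
  · obtain ⟨h₀, h₁⟩ := hqt.1 h
    simp only [sequenceNorm, h, h₀, h₁, if_true]
    refine iSup_le fun j => ?_
    gcongr
    · exact le_iSup b₀ j
    · exact le_iSup b₁ j
  have hq' : 0 < q.toReal := ENNReal.toReal_pos hq.ne' h
  have hpow : ∀ x y : ℝ≥0∞, (x ^ (1 - Θ) * y ^ Θ) ^ q.toReal =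
      x ^ ((1 - Θ) * q.toReal) * y ^ (Θ * q.toReal) := by
    intro x y
    rw [ENNReal.mul_rpow_of_nonneg _ _ hq'.le, ← ENNReal.rpow_mul, ← ENNReal.rpow_mul]
  by_cases h₀ : q₀ = ∞
  · have h₁ : q₁ ≠ ∞ := fun h₁ => h (hqt.2 ⟨h₀, h₁⟩)
    have hq₁' : 0 < q₁.toReal := ENNReal.toReal_pos hq₁.ne' h₁
    -- Since `∞.toReal = 0` and division by 0 gives 0, the q₀-term drops out, as 1/∞ = 0 demands.
    have hΘq : Θ * q.toReal = q₁.toReal := by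
      rw [h₀, ENNReal.toReal_top, div_zero, zero_add] at hqr
      field_simp at hqr
      linarith
    simp only [sequenceNorm, h, h₀, h₁, if_true, if_false, hpow, hΘq]
    calc (∑' j, b₀ j ^ ((1 - Θ) * q.toReal) * b₁ j ^ q₁.toReal) ^ (1 / q.toReal)
        ≤ (∑' j, (⨆ j, b₀ j) ^ ((1 - Θ) * q.toReal) * b₁ j ^ q₁.toReal) ^ (1 / q.toReal) := by
          gcongr with j
          exact le_iSup b₀ j
      _ = _ := by
          rw [ENNReal.tsum_mul_left, ENNReal.mul_rpow_of_nonneg _ _ (by positivity),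
            ← ENNReal.rpow_mul, ← ENNReal.rpow_mul]
          congr 2
          · field_simp
          · rw [← hΘq]; field_simp
  have hq₀' : 0 < q₀.toReal := ENNReal.toReal_pos hq₀.ne' h₀
  by_cases h₁ : q₁ = ∞
  · have hΘq : (1 - Θ) * q.toReal = q₀.toReal := by
      rw [h₁, ENNReal.toReal_top, div_zero, add_zero] at hqr
      field_simp at hqr
      linarith
    simp only [sequenceNorm, h, h₀, h₁, if_true, if_false, hpow, hΘq]
    calc (∑' j, b₀ j ^ q₀.toReal * b₁ j ^ (Θ * q.toReal)) ^ (1 / q.toReal)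
        ≤ (∑' j, b₀ j ^ q₀.toReal * (⨆ j, b₁ j) ^ (Θ * q.toReal)) ^ (1 / q.toReal) := by
          gcongr with j
          exact le_iSup b₁ j
      _ = _ := by
          rw [ENNReal.tsum_mul_right, ENNReal.mul_rpow_of_nonneg _ _ (by positivity),
            ← ENNReal.rpow_mul, ← ENNReal.rpow_mul]
          congr 2
          · rw [← hΘq]; field_simp
          · field_simp
  have hq₁' : 0 < q₁.toReal := ENNReal.toReal_pos hq₁.ne' h₁
  simp only [sequenceNorm, h, h₀, h₁, if_false, hpow]
  have hsum : (1 - Θ) * q.toReal / q₀.toReal + Θ * q.toReal / q₁.toReal = 1 := by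
    have : ((1 - Θ) / q₀.toReal + Θ / q₁.toReal) * q.toReal = 1 := by
      rw [← hqr, one_div_mul_cancel hq'.ne']
    exact (by ring : _ = _).trans this
  calc (∑' j, b₀ j ^ ((1 - Θ) * q.toReal) * b₁ j ^ (Θ * q.toReal)) ^ (1 / q.toReal)
      = (∑' j, (b₀ j ^ q₀.toReal) ^ ((1 - Θ) * q.toReal / q₀.toReal) *
          (b₁ j ^ q₁.toReal) ^ (Θ * q.toReal / q₁.toReal)) ^ (1 / q.toReal) := by
        congr 1
        refine tsum_congr fun j => ?_
        rw [← ENNReal.rpow_mul, ← ENNReal.rpow_mul, mul_div_cancel₀ _ hq₀'.ne',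
          mul_div_cancel₀ _ hq₁'.ne']
    _ ≤ ((∑' j, b₀ j ^ q₀.toReal) ^ ((1 - Θ) * q.toReal / q₀.toReal) *
          (∑' j, b₁ j ^ q₁.toReal) ^ (Θ * q.toReal / q₁.toReal)) ^ (1 / q.toReal) := by
        gcongr
        exact ENNReal.tsum_mul_rpow_le _ _ (by positivity) (by positivity) hsum
    _ = _ := by
        rw [ENNReal.mul_rpow_of_nonneg _ _ (by positivity), ← ENNReal.rpow_mul,
          ← ENNReal.rpow_mul, ← ENNReal.rpow_mul, ← ENNReal.rpow_mul]
        congr 2 <;> field_simp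

/-- The exponent `q / q₀`, with `∞ / ∞ = 1`. -/
noncomputable def exponentRatio (q q₀ : ℝ≥0∞) : ℝ :=
  if q = ∞ then 1 else q.toReal / q₀.toReal

/-- The cut-off at `c j = 0` matters when the exponent is 0, where `0 ^ 0 = 1` would create spurious
terms. -/
lemma sequenceNorm_rpow_mul_le {q₀ q : ℝ≥0∞} (hq₀ : 0 < q₀) (hq : 0 < q) (hqt : q = ∞ → q₀ = ∞)
    (c : ℕ → ℝ≥0∞) (U : ℝ≥0∞) :
    sequenceNorm q₀ (fun j => if c j = 0 then 0 else c j ^ exponentRatio q q₀ * U) ≤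
      sequenceNorm q c ^ exponentRatio q q₀ * U := by
  unfold exponentRatio
  by_cases h : q = ∞
  · simp only [sequenceNorm, h, hqt h, if_true, ENNReal.rpow_one]
    refine iSup_le fun j => ?_
    split_ifs
    · exact zero_le
    · gcongr
      exact le_iSup c j
  have hq' : 0 < q.toReal := ENNReal.toReal_pos hq.ne' h
  -- For q < ∞ = q₀ the ratio is 0 because `q.toReal / 0 = 0`, and the bound reduces to `U ≤ U`.
  by_cases h₀ : q₀ = ∞
  · simp only [sequenceNorm, h, h₀, if_true, if_false, ENNReal.toReal_top, div_zero,
      ENNReal.rpow_zero, one_mul]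
    refine iSup_le fun j => ?_
    split_ifs
    · exact zero_le
    · exact le_rfl
  have hq₀' : 0 < q₀.toReal := ENNReal.toReal_pos hq₀.ne' h₀
  simp only [sequenceNorm, h, h₀, if_false]
  calc _ ≤ (∑' j, c j ^ q.toReal * U ^ q₀.toReal) ^ (1 / q₀.toReal) := by
        gcongr with j
        split_ifs with hc
        · rw [ENNReal.zero_rpow_of_pos hq₀']; exact zero_le
        · rw [ENNReal.mul_rpow_of_nonneg _ _ hq₀'.le, ← ENNReal.rpow_mul,
            div_mul_cancel₀ _ hq₀'.ne']
    _ = _ := by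
        rw [ENNReal.tsum_mul_right, ENNReal.mul_rpow_of_nonneg _ _ (by positivity),
          ← ENNReal.rpow_mul, ← ENNReal.rpow_mul, mul_one_div_cancel hq₀'.ne', ENNReal.rpow_one]
        congr 2
        field_simp

/-! ### Norms of the sequence spaces -/

section FNorm

variable {d : ℕ} {w : EuclideanSpace ℝ (Fin d) → ℝ}

lemma fNorm_rpow_eq (hw : AEMeasurable (fun x => ENNReal.ofReal (w x)) volume) {p : ℝ} (hp : 0 < p)
    (s : ℝ) {q : ℝ≥0∞} (hq : 0 < q) (a : ℕ × (Fin d → ℤ) → ℂ) :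
    fNorm s p q w a ^ p = ∫⁻ x, dyadicSquareFunction s q a x ^ p
      ∂(volume.withDensity fun x => ENNReal.ofReal (w x)) := by
  rw [fNorm, weightedLpNorm, ← ENNReal.rpow_mul, one_div_mul_cancel hp.ne', ENNReal.rpow_one,
    lintegral_withDensity_eq_lintegral_mul₀ hw
      ((measurable_dyadicSquareFunction s hq a).pow_const p).aemeasurable]
  simp only [Pi.mul_apply, mul_comm]

lemma withDensity_ne_top_of_isBounded (hw : LocallyIntegrable w volume)
    {K : Set (EuclideanSpace ℝ (Fin d))} (hK : Bornology.IsBounded K) :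
    (volume.withDensity fun x => ENNReal.ofReal (w x)) K ≠ ∞ := by
  obtain ⟨R, hR⟩ := hK.subset_closedBall 0
  refine ne_top_of_le_ne_top ?_ (measure_mono hR)
  rw [withDensity_apply _ measurableSet_closedBall]
  have h := hw.integrableOn_isCompact (isCompact_closedBall (0 : EuclideanSpace ℝ (Fin d)) R)
  refine ne_top_of_le_ne_top h.hasFiniteIntegral.ne (lintegral_mono fun x => ?_)
  exact Real.ofReal_le_enorm _

/-- In the quasi-norm of `f^s_{p,q}(w)`, with a local Muckenhoupt weight `w`, the cubes can be
replaced by subsets containing at least half of their Lebesgue measure. -/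
theorem IsLocalMuckenhoupt.exists_fNorm_rpow_le (hd : 1 ≤ d) {r : ℝ} (hr : 1 < r)
    (hw : IsLocalMuckenhoupt r w) {p : ℝ} (hp : 0 < p) {q : ℝ≥0∞} (hq : 0 < q) (s : ℝ) :
    ∃ C : ℝ≥0∞, C ≠ ∞ ∧ ∀ (E : ℕ → (Fin d → ℤ) → Set (EuclideanSpace ℝ (Fin d)))
      (a : ℕ × (Fin d → ℤ) → ℂ), (∀ j k, MeasurableSet (E j k)) →
      (∀ j k, E j k ⊆ dyadicCube j k) →
      (∀ j k, 2⁻¹ * volume (dyadicCube j k) ≤ volume (E j k)) →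
      fNorm s p q w a ^ p ≤ C * ∫⁻ x, sequenceNorm q (fun j => ((E j (dyadicIndex j x)).indicator
        (fun x => dyadicCoeff s a j (dyadicIndex j x)) x : ℝ≥0)) ^ p * ENNReal.ofReal (w x) := by
  set ν := volume.withDensity fun x => ENNReal.ofReal (w x) with hν
  obtain ⟨C₁, hC₁, h₁⟩ := hw.cubeComparable hd hr 1 2⁻¹ (by simp)
  -- Finite unions of unit cubes: level-0 measurable, exhausting the space, and of finite ν-measure
  -- by local integrability.
  set K : ℕ → Set (EuclideanSpace ℝ (Fin d)) :=
    fun n => {x | ∀ l, |dyadicIndex 0 x l| ≤ n} with hK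
  have hKm : ∀ n, MeasurableSet[dyadicFiltration d 0] (K n) := fun n =>
    ⟨{k | ∀ l, |k l| ≤ n}, MeasurableSet.of_discrete, rfl⟩
  have hKν : ∀ n, ν (K n) ≠ ∞ := by
    intro n
    refine withDensity_ne_top_of_isBounded hw.2.1 ?_
    refine isBounded_iff_forall_norm_le.2 ⟨√(d * (n + 1) ^ 2), fun x hx => ?_⟩
    rw [EuclideanSpace.norm_eq]
    refine Real.sqrt_le_sqrt ?_
    calc ∑ l, ‖x l‖ ^ 2 ≤ ∑ _l : Fin d, ((n : ℝ) + 1) ^ 2 := by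
          refine Finset.sum_le_sum fun l _ => ?_
          have hl := abs_le.1 (hx l)
          have h1 : ⌊x l⌋ ≤ (n : ℤ) := by simpa [dyadicIndex] using hl.2
          have h2 : -(n : ℤ) ≤ ⌊x l⌋ := by simpa [dyadicIndex] using hl.1
          have h3 := Int.lt_floor_add_one (x l)
          have h4 := Int.floor_le (x l)
          have h1' : (⌊x l⌋ : ℝ) ≤ n := by exact_mod_cast h1
          have h2' : -(n : ℝ) ≤ ⌊x l⌋ := by exact_mod_cast h2
          refine pow_le_pow_left₀ (norm_nonneg _) ?_ 2
          rw [Real.norm_eq_abs, abs_le]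
          constructor <;> linarith
      _ = _ := by simp
  have hKmono : Monotone K := by
    intro m n hmn x hx l
    exact (hx l).trans (by exact_mod_cast hmn)
  have hKu : ∀ x, ∃ n, x ∈ K n := by
    intro x
    obtain ⟨n, hn⟩ := (Finset.univ.image fun l => |dyadicIndex 0 x l|).exists_le
    exact ⟨n.toNat, fun l => (hn _ (by simp)).trans (Int.self_le_toNat n)⟩
  obtain ⟨C, hC, h⟩ := IsThick.exists_lintegral_sequenceNorm_le (ν := ν) hC₁ hKm
    hKν hKmono hKu hp hq
  refine ⟨C, hC, fun E a hEm hEs hEv => ?_⟩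
  have hthick : IsThick ν (dyadicFiltration d) (fun j => ⋃ k, E j k) C₁ := by
    refine isThick_dyadicFiltration hEm hEs fun j k => ?_
    have hs := hEs j k
    have hv := hEv j k
    rw [dyadicCube_eq_halfOpenCube] at hs hv ⊢
    refine h₁ _ _ _ (by positivity) ?_ (hEm j k) hs hv
    exact zpow_le_one_of_nonpos₀ one_le_two (by simp)
  have := h _ (fun j x => dyadicCoeff s a j (dyadicIndex j x)) hthick
    fun j => measurable_comp_dyadicIndex j _
  rw [fNorm_rpow_eq hw.aemeasurable hp s hq]
  simp only [dyadicSquareFunction_eq s hq]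
  refine this.trans_eq ?_
  congr 1
  have hind : ∀ j x, (⋃ k, E j k).indicator (fun x => dyadicCoeff s a j (dyadicIndex j x)) x =
      (E j (dyadicIndex j x)).indicator (fun x => dyadicCoeff s a j (dyadicIndex j x)) x := by
    intro j x
    have hiff : x ∈ ⋃ k, E j k ↔ x ∈ E j (dyadicIndex j x) := by
      refine ⟨fun hx => ?_, fun hx => Set.mem_iUnion.2 ⟨_, hx⟩⟩
      obtain ⟨k, hk⟩ := Set.mem_iUnion.1 hx
      rwa [mem_dyadicCube_iff.1 (hEs j k hk)]
    by_cases hx : x ∈ E j (dyadicIndex j x)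
    · rw [Set.indicator_of_mem hx, Set.indicator_of_mem (hiff.2 hx)]
    · rw [Set.indicator_of_notMem hx, Set.indicator_of_notMem fun h => hx (hiff.1 h)]
  have hm : Measurable fun x => sequenceNorm q (fun j => ((⋃ k, E j k).indicator
      (fun x => dyadicCoeff s a j (dyadicIndex j x)) x : ℝ≥0)) := by
    refine measurable_sequenceNorm fun j => Measurable.coe_nnreal_ennreal ?_
    exact ((measurable_comp_dyadicIndex j _).mono ((dyadicFiltration d).le j) le_rfl).indicator
      (MeasurableSet.iUnion (hEm j))
  rw [lintegral_withDensity_eq_lintegral_mul₀ hw.aemeasurable (hm.pow_const p).aemeasurable]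
  simp only [Pi.mul_apply, hind, mul_comm]
end FNorm

/-! ### Calderón products of the sequence spaces -/

section Exponents

lemma ENNReal.exists_eq_ofReal_exp {x : ℝ≥0∞} (h0 : x ≠ 0) (ht : x ≠ ∞) :
    ∃ y : ℝ, x = ENNReal.ofReal (Real.exp y) :=
  ⟨Real.log x.toReal, by
    rw [Real.exp_log (ENNReal.toReal_pos h0 ht), ENNReal.ofReal_toReal ht]⟩

lemma ENNReal.rpow_mul_monomial {g V₀ V₁ : ℝ≥0∞} (hg0 : g ≠ 0) (hgt : g ≠ ∞) (h₀0 : V₀ ≠ 0)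
    (h₀t : V₀ ≠ ∞) (h₁0 : V₁ ≠ 0) (h₁t : V₁ ≠ ∞) (α κ γ δ t r m n : ℝ) :
    (g ^ α * (g ^ κ * V₀ ^ δ * V₁ ^ γ) ^ t) ^ r * (V₀ ^ m * V₁ ^ n) =
      g ^ ((α + κ * t) * r) * (V₀ ^ (δ * t * r + m) * V₁ ^ (γ * t * r + n)) := by
  obtain ⟨x, rfl⟩ := ENNReal.exists_eq_ofReal_exp hg0 hgt
  obtain ⟨y, rfl⟩ := ENNReal.exists_eq_ofReal_exp h₀0 h₀t
  obtain ⟨z, rfl⟩ := ENNReal.exists_eq_ofReal_exp h₁0 h₁t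
  simp only [ENNReal.ofReal_rpow_of_pos (Real.exp_pos _), ← Real.exp_mul,
    ← ENNReal.ofReal_mul (Real.exp_nonneg _), ← Real.exp_add]
  congr 2
  ring

lemma exponentRatio_eq {Θ : ℝ} (hΘ₀ : 0 < Θ) (hΘ₁ : Θ < 1) {q₀ q₁ q : ℝ≥0∞} (hq₀ : 0 < q₀)
    (hq₁ : 0 < q₁) (hq : 1 / q = ENNReal.ofReal (1 - Θ) / q₀ + ENNReal.ofReal Θ / q₁) :
    0 < q ∧ (q = ∞ ↔ q₀ = ∞ ∧ q₁ = ∞) ∧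
      1 / q.toReal = (1 - Θ) / q₀.toReal + Θ / q₁.toReal ∧
      (1 - Θ) * exponentRatio q q₀ + Θ * exponentRatio q q₁ = 1 := by
  have hΘ : 0 < 1 - Θ := by linarith
  have h₀t : ENNReal.ofReal (1 - Θ) / q₀ ≠ ∞ := ENNReal.div_ne_top ENNReal.ofReal_ne_top hq₀.ne'
  have h₁t : ENNReal.ofReal Θ / q₁ ≠ ∞ := ENNReal.div_ne_top ENNReal.ofReal_ne_top hq₁.ne'
  have hq0 : 0 < q := by
    rw [pos_iff_ne_zero]
    rintro rfl
    rw [ENNReal.div_zero one_ne_zero] at hq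
    exact ENNReal.add_ne_top.2 ⟨h₀t, h₁t⟩ hq.symm
  have hr : 1 / q.toReal = (1 - Θ) / q₀.toReal + Θ / q₁.toReal := by
    have := congrArg ENNReal.toReal hq
    rwa [ENNReal.toReal_add h₀t h₁t, ENNReal.toReal_div, ENNReal.toReal_div, ENNReal.toReal_div,
      ENNReal.toReal_one, ENNReal.toReal_ofReal hΘ.le, ENNReal.toReal_ofReal hΘ₀.le] at this
  have htop : q = ∞ ↔ q₀ = ∞ ∧ q₁ = ∞ := by
    have : q = ∞ ↔ 1 / q = 0 := by simp
    rw [this, hq, add_eq_zero]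
    simp [ENNReal.div_eq_zero_iff, hΘ₀.not_ge, hΘ₁.not_ge]
  refine ⟨hq0, htop, hr, ?_⟩
  unfold exponentRatio
  split_ifs with h
  · ring
  · have hq' : 0 < q.toReal := ENNReal.toReal_pos hq0.ne' h
    calc _ = ((1 - Θ) / q₀.toReal + Θ / q₁.toReal) * q.toReal := by ring
      _ = 1 := by rw [← hr, one_div_mul_cancel hq'.ne']

end Exponents

section Factorization

variable {d : ℕ}

/-- The factor with the coefficients `2^(j s₀) |b_Q| = (2^(js) |a_Q|)^α M_Q^t`. -/
noncomputable def calderonFactor (s₀ s α t : ℝ) (M : ℕ → (Fin d → ℤ) → ℝ≥0)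
    (a : ℕ × (Fin d → ℤ) → ℂ) : ℕ × (Fin d → ℤ) → ℂ := fun jk =>
  ((2 ^ (-(s₀ * (jk.1 : ℝ))) * (if a jk = 0 then 0 else
    dyadicCoeff s a jk.1 jk.2 ^ α * M jk.1 jk.2 ^ t : ℝ≥0) : ℝ) : ℂ)

lemma norm_calderonFactor (s₀ s α t : ℝ) (M : ℕ → (Fin d → ℤ) → ℝ≥0)
    (a : ℕ × (Fin d → ℤ) → ℂ) (j : ℕ) (k : Fin d → ℤ) :
    ‖calderonFactor s₀ s α t M a (j, k)‖ = 2 ^ (-(s₀ * (j : ℝ))) *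
      (if a (j, k) = 0 then 0 else dyadicCoeff s a j k ^ α * M j k ^ t : ℝ≥0) := by
  rw [calderonFactor, Complex.norm_real, Real.norm_of_nonneg (by positivity)]

lemma dyadicCoeff_calderonFactor (s₀ s α t : ℝ) (M : ℕ → (Fin d → ℤ) → ℝ≥0)
    (a : ℕ × (Fin d → ℤ) → ℂ) (j : ℕ) (k : Fin d → ℤ) :
    dyadicCoeff s₀ (calderonFactor s₀ s α t M a) j k =
      if a (j, k) = 0 then 0 else dyadicCoeff s a j k ^ α * M j k ^ t := by
  rw [dyadicCoeff, norm_calderonFactor, ← mul_assoc, ← Real.rpow_add two_pos, add_neg_cancel,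
    Real.rpow_zero, one_mul, Real.toNNReal_coe]

lemma coe_dyadicCoeff (s : ℝ) (a : ℕ × (Fin d → ℤ) → ℂ) (j : ℕ) (k : Fin d → ℤ) :
    (dyadicCoeff s a j k : ℝ) = (2 : ℝ) ^ (s * (j : ℝ)) * ‖a (j, k)‖ :=
  Real.coe_toNNReal _ (by positivity)

lemma dyadicCoeff_eq_zero_iff {s : ℝ} {a : ℕ × (Fin d → ℤ) → ℂ} {j : ℕ} {k : Fin d → ℤ} :
    dyadicCoeff s a j k = 0 ↔ a (j, k) = 0 := by
  rw [← NNReal.coe_eq_zero, coe_dyadicCoeff, mul_eq_zero, norm_eq_zero]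
  simp [(Real.rpow_pos_of_pos two_pos _).ne']

/-- The powers of M_Q cancel because Θ(1-Θ) - (1-Θ)Θ = 0. In logarithmic form the claim is a linear
identity. -/
lemma norm_le_calderonFactor {Θ s₀ s₁ s α₀ α₁ : ℝ} (hs : s = (1 - Θ) * s₀ + Θ * s₁)
    (hα : (1 - Θ) * α₀ + Θ * α₁ = 1) {M : ℕ → (Fin d → ℤ) → ℝ≥0} (hM : ∀ j k, M j k ≠ 0)
    (a : ℕ × (Fin d → ℤ) → ℂ) (jk : ℕ × (Fin d → ℤ)) :
    ‖a jk‖ ≤ ‖calderonFactor s₀ s α₀ Θ M a jk‖ ^ (1 - Θ) *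
      ‖calderonFactor s₁ s α₁ (-(1 - Θ)) M a jk‖ ^ Θ := by
  obtain ⟨j, k⟩ := jk
  rcases eq_or_ne (a (j, k)) 0 with h | h
  · rw [h, norm_zero]; positivity
  rw [norm_calderonFactor, norm_calderonFactor, if_neg h, if_neg h]
  push_cast
  have hc : (0 : ℝ) < dyadicCoeff s a j k :=
    NNReal.coe_pos.2 (pos_iff_ne_zero.2 (dyadicCoeff_eq_zero_iff.not.2 h))
  have hm : (0 : ℝ) < M j k := NNReal.coe_pos.2 (pos_iff_ne_zero.2 (hM j k))
  have ha : ‖a (j, k)‖ = 2 ^ (-(s * (j : ℝ))) * dyadicCoeff s a j k := by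
    rw [coe_dyadicCoeff, ← mul_assoc, ← Real.rpow_add two_pos, neg_add_cancel, Real.rpow_zero,
      one_mul]
  rw [ha]
  obtain ⟨x, hx⟩ : ∃ x, Real.exp x = dyadicCoeff s a j k := ⟨_, Real.exp_log hc⟩
  obtain ⟨y, hy⟩ : ∃ y, Real.exp y = M j k := ⟨_, Real.exp_log hm⟩
  obtain ⟨z, hz⟩ : ∃ z, Real.exp z = 2 := ⟨_, Real.exp_log two_pos⟩
  rw [← hx, ← hy, ← hz]
  simp only [← Real.exp_mul, ← Real.exp_add]
  refine le_of_eq (congrArg Real.exp ?_)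
  rw [hs]
  linear_combination (-x) * hα

/-- The quasi-norm of a factor of the Calderón product is controlled by a pointwise identity, if the
numbers `M_Q ^ t` are bounded by the function `u ^ t` on large parts of the cubes. -/
lemma IsLocalMuckenhoupt.exists_fNorm_calderonFactor_le (hd : 1 ≤ d)
    {w₀ : EuclideanSpace ℝ (Fin d) → ℝ} {r : ℝ} (hr : 1 < r) (hw₀ : IsLocalMuckenhoupt r w₀)
    {p₀ : ℝ} (hp₀ : 0 < p₀) {q₀ q : ℝ≥0∞} (hq₀ : 0 < q₀) (hq : 0 < q) (hqt : q = ∞ → q₀ = ∞)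
    (s₀ s p t : ℝ) (hp : 0 < p) :
    ∃ C : ℝ≥0∞, C ≠ ∞ ∧ ∀ (w : EuclideanSpace ℝ (Fin d) → ℝ)
      (E : ℕ → (Fin d → ℤ) → Set (EuclideanSpace ℝ (Fin d))) (M : ℕ → (Fin d → ℤ) → ℝ≥0)
      (u : EuclideanSpace ℝ (Fin d) → ℝ≥0∞) (a : ℕ × (Fin d → ℤ) → ℂ),
      (∀ j k, MeasurableSet (E j k)) → (∀ j k, M j k ≠ 0) →
      (∀ j k, a (j, k) ≠ 0 →
        2⁻¹ * volume (dyadicCube j k) ≤ volume (dyadicCube j k ∩ E j k)) →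
      (∀ j k, ∀ x ∈ E j k, (M j k : ℝ≥0∞) ^ t ≤ u x ^ t) →
      (∀ᵐ x, dyadicSquareFunction s q a x ≠ 0 →
        (dyadicSquareFunction s q a x ^ exponentRatio q q₀ * u x ^ t) ^ p₀ *
          ENNReal.ofReal (w₀ x) ≤ dyadicSquareFunction s q a x ^ p * ENNReal.ofReal (w x)) →
      fNorm s₀ p₀ q₀ w₀ (calderonFactor s₀ s (exponentRatio q q₀) t M a) ^ p₀ ≤
        C * fNorm s p q w a ^ p := by
  obtain ⟨C, hC, h⟩ := hw₀.exists_fNorm_rpow_le hd hr hp₀ hq₀ s₀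
  refine ⟨C, hC, fun w E M u a hEm hM hEv hEu hae => ?_⟩
  -- Where the coefficient vanishes no median bound is available or needed, so the whole cube is
  -- kept.
  set E' : ℕ → (Fin d → ℤ) → Set (EuclideanSpace ℝ (Fin d)) := fun j k =>
    if a (j, k) = 0 then dyadicCube j k else dyadicCube j k ∩ E j k with hE'
  refine (h E' _ (fun j k => ?_) (fun j k => ?_) fun j k => ?_).trans ?_
  · simp only [hE']
    split_ifs
    · exact measurableSet_dyadicCube j k
    · exact (measurableSet_dyadicCube j k).inter (hEm j k)
  · simp only [hE']
    split_ifs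
    · exact subset_rfl
    · exact Set.inter_subset_left
  · simp only [hE']
    split_ifs with ha
    · exact mul_le_of_le_one_left zero_le (by simp)
    · exact hEv j k ha
  · rw [fNorm, weightedLpNorm, ← ENNReal.rpow_mul, one_div_mul_cancel hp.ne', ENNReal.rpow_one]
    gcongr 1
    refine lintegral_mono_ae (hae.mono fun x hx => ?_)
    have hterm : ∀ j, (((E' j (dyadicIndex j x)).indicator (fun x => dyadicCoeff s₀
        (calderonFactor s₀ s (exponentRatio q q₀) t M a) j (dyadicIndex j x)) x : ℝ≥0) : ℝ≥0∞) ≤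
        if (dyadicCoeff s a j (dyadicIndex j x) : ℝ≥0∞) = 0 then 0 else
          (dyadicCoeff s a j (dyadicIndex j x) : ℝ≥0∞) ^ exponentRatio q q₀ * u x ^ t := by
      intro j
      by_cases hxE : x ∈ E' j (dyadicIndex j x)
      · rw [Set.indicator_of_mem hxE, dyadicCoeff_calderonFactor]
        by_cases ha : a (j, dyadicIndex j x) = 0
        · simp [ha]
        · have hc : dyadicCoeff s a j (dyadicIndex j x) ≠ 0 := dyadicCoeff_eq_zero_iff.not.2 ha
          rw [if_neg ha, if_neg (by simpa using hc), ENNReal.coe_mul,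
            ENNReal.coe_rpow_of_ne_zero hc, ENNReal.coe_rpow_of_ne_zero (hM _ _)]
          simp only [hE', if_neg ha] at hxE
          exact mul_le_mul' le_rfl (hEu _ _ x hxE.2)
      · rw [Set.indicator_of_notMem hxE]; exact zero_le
    -- The pointwise hypothesis is void where g = 0, but there all coefficients along x vanish.
    rcases eq_or_ne (dyadicSquareFunction s q a x) 0 with h0 | h0
    · have hz : ∀ j, (dyadicCoeff s a j (dyadicIndex j x) : ℝ≥0∞) = 0 := fun j =>
        le_antisymm ((dyadicCoeff_le_dyadicSquareFunction s hq a j x).trans_eq h0) zero_le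
      have : sequenceNorm q₀ (fun j => (((E' j (dyadicIndex j x)).indicator (fun x => dyadicCoeff s₀
          (calderonFactor s₀ s (exponentRatio q q₀) t M a) j (dyadicIndex j x)) x : ℝ≥0) : ℝ≥0∞))
          ≤ 0 := by
        refine (sequenceNorm_mono hterm).trans_eq ?_
        simp only [hz, if_true]
        exact sequenceNorm_zero hq₀
      rw [le_antisymm this zero_le, ENNReal.zero_rpow_of_pos hp₀, zero_mul]
      exact zero_le
    · refine le_trans ?_ (hx h0)
      gcongr
      refine (sequenceNorm_mono hterm).trans ?_
      rw [dyadicSquareFunction_eq s hq]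
      exact sequenceNorm_rpow_mul_le hq₀ hq hqt _ _

lemma ENNReal.rpow_neg_le_rpow_neg {x y : ℝ≥0∞} {t : ℝ} (h : x ≤ y) (ht : 0 ≤ t) :
    y ^ (-t) ≤ x ^ (-t) := by
  rw [ENNReal.rpow_neg, ENNReal.rpow_neg, ENNReal.inv_le_inv]
  exact ENNReal.rpow_le_rpow h ht

lemma volume_dyadicCube (j : ℕ) (k : Fin d → ℤ) :
    volume (dyadicCube j k) ≠ 0 ∧ volume (dyadicCube j k) ≠ ∞ := by
  rw [dyadicCube_eq_halfOpenCube, volume_halfOpenCube]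
  constructor <;> simp

lemma ae_ne_top_of_lintegral_rpow_mul {X : Type*} [MeasurableSpace X] {μ : Measure X}
    {F W : X → ℝ≥0∞} {p : ℝ} (hp : 0 < p) (hF : Measurable F) (hW : AEMeasurable W μ)
    (hW0 : ∀ᵐ x ∂μ, W x ≠ 0) (h : ∫⁻ x, F x ^ p * W x ∂μ ≠ ∞) : ∀ᵐ x ∂μ, F x ≠ ∞ := by
  filter_upwards [ae_lt_top' ((hF.pow_const p).aemeasurable.mul hW) h, hW0] with x hx hx0 hFt
  change F x ^ p * W x < ∞ at hx
  rw [hFt, ENNReal.top_rpow_of_pos hp, ENNReal.top_mul hx0] at hx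
  exact hx.false

variable {Θ p₀ p₁ p : ℝ} {w₀ w₁ w : EuclideanSpace ℝ (Fin d) → ℝ}

lemma ofReal_weight_eq (hw₀ : ∀ x, 0 ≤ w₀ x) (hw₁ : ∀ x, 0 ≤ w₁ x) {m n : ℝ} (hm : 0 ≤ m)
    (hn : 0 ≤ n) (hw : ∀ x, w x = w₀ x ^ m * w₁ x ^ n) (x : EuclideanSpace ℝ (Fin d)) :
    ENNReal.ofReal (w x) = ENNReal.ofReal (w₀ x) ^ m * ENNReal.ofReal (w₁ x) ^ n := by
  rw [hw, ENNReal.ofReal_mul (Real.rpow_nonneg (hw₀ x) _),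
    ENNReal.ofReal_rpow_of_nonneg (hw₀ x) hm, ENNReal.ofReal_rpow_of_nonneg (hw₁ x) hn]

/-- Hölder's inequality for the sequence spaces. -/
lemma fNorm_le_of_norm_le (hΘ₀ : 0 < Θ) (hΘ₁ : Θ < 1) (hp₀ : 0 < p₀) (hp₁ : 0 < p₁)
    (hp0 : 0 < p) (hp : 1 / p = (1 - Θ) / p₀ + Θ / p₁)
    {q₀ q₁ q : ℝ≥0∞} (hq₀ : 0 < q₀) (hq₁ : 0 < q₁)
    (hq : 1 / q = ENNReal.ofReal (1 - Θ) / q₀ + ENNReal.ofReal Θ / q₁)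
    {s₀ s₁ s : ℝ} (hs : s = (1 - Θ) * s₀ + Θ * s₁)
    (hw₀ : ∀ x, 0 ≤ w₀ x) (hw₁ : ∀ x, 0 ≤ w₁ x)
    (hw₀m : AEMeasurable (fun x => ENNReal.ofReal (w₀ x)) volume)
    (hw₁m : AEMeasurable (fun x => ENNReal.ofReal (w₁ x)) volume)
    (hw : ∀ x, w x = w₀ x ^ ((1 - Θ) * p / p₀) * w₁ x ^ (Θ * p / p₁))
    {a a₀ a₁ : ℕ × (Fin d → ℤ) → ℂ} (ha : ∀ x, ‖a x‖ ≤ ‖a₀ x‖ ^ (1 - Θ) * ‖a₁ x‖ ^ Θ) :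
    fNorm s p q w a ≤ fNorm s₀ p₀ q₀ w₀ a₀ ^ (1 - Θ) * fNorm s₁ p₁ q₁ w₁ a₁ ^ Θ := by
  have hΘ : 0 < 1 - Θ := by linarith
  obtain ⟨hq0, hqt, hqr, -⟩ := exponentRatio_eq hΘ₀ hΘ₁ hq₀ hq₁ hq
  have hmn : (1 - Θ) * p / p₀ + Θ * p / p₁ = 1 := by
    calc _ = ((1 - Θ) / p₀ + Θ / p₁) * p := by ring
      _ = 1 := by rw [← hp, one_div_mul_cancel hp0.ne']
  have hcoeff : ∀ j k, (dyadicCoeff s a j k : ℝ≥0∞) ≤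
      (dyadicCoeff s₀ a₀ j k : ℝ≥0∞) ^ (1 - Θ) * (dyadicCoeff s₁ a₁ j k : ℝ≥0∞) ^ Θ := by
    intro j k
    rw [← ENNReal.coe_rpow_of_nonneg _ hΘ.le, ← ENNReal.coe_rpow_of_nonneg _ hΘ₀.le,
      ← ENNReal.coe_mul, ENNReal.coe_le_coe, ← NNReal.coe_le_coe]
    push_cast
    rw [coe_dyadicCoeff, coe_dyadicCoeff, coe_dyadicCoeff,
      Real.mul_rpow (by positivity) (norm_nonneg _), Real.mul_rpow (by positivity) (norm_nonneg _),
      ← Real.rpow_mul two_pos.le, ← Real.rpow_mul two_pos.le]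
    calc (2 : ℝ) ^ (s * (j : ℝ)) * ‖a (j, k)‖
        ≤ 2 ^ (s * (j : ℝ)) * (‖a₀ (j, k)‖ ^ (1 - Θ) * ‖a₁ (j, k)‖ ^ Θ) := by
          gcongr; exact ha _
      _ = _ := by
          have : s * (j : ℝ) = s₀ * j * (1 - Θ) + s₁ * j * Θ := by rw [hs]; ring
          rw [this, Real.rpow_add two_pos]
          ring
  have hg : ∀ x, dyadicSquareFunction s q a x ≤
      dyadicSquareFunction s₀ q₀ a₀ x ^ (1 - Θ) * dyadicSquareFunction s₁ q₁ a₁ x ^ Θ := by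
    intro x
    rw [dyadicSquareFunction_eq s hq0, dyadicSquareFunction_eq s₀ hq₀,
      dyadicSquareFunction_eq s₁ hq₁]
    exact (sequenceNorm_mono fun j => hcoeff j _).trans
      (sequenceNorm_mul_rpow_le hq₀ hq₁ hq0 hΘ₀ hΘ₁ hqt hqr _ _)
  unfold fNorm weightedLpNorm
  calc _ ≤ (∫⁻ x, (dyadicSquareFunction s₀ q₀ a₀ x ^ p₀ * ENNReal.ofReal (w₀ x)) ^
            ((1 - Θ) * p / p₀) * (dyadicSquareFunction s₁ q₁ a₁ x ^ p₁ *
            ENNReal.ofReal (w₁ x)) ^ (Θ * p / p₁)) ^ (1 / p) := by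
        refine ENNReal.rpow_le_rpow (lintegral_mono fun x => ?_) (by positivity)
        rw [ofReal_weight_eq hw₀ hw₁ (by positivity) (by positivity) hw,
          ENNReal.mul_rpow_of_nonneg _ _ (by positivity),
          ENNReal.mul_rpow_of_nonneg _ _ (by positivity), ← ENNReal.rpow_mul, ← ENNReal.rpow_mul,
          mul_div_cancel₀ _ hp₀.ne', mul_div_cancel₀ _ hp₁.ne', mul_mul_mul_comm]
        gcongr
        refine (ENNReal.rpow_le_rpow (hg x) hp0.le).trans_eq ?_
        rw [ENNReal.mul_rpow_of_nonneg _ _ hp0.le, ← ENNReal.rpow_mul, ← ENNReal.rpow_mul]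
    _ ≤ ((∫⁻ x, dyadicSquareFunction s₀ q₀ a₀ x ^ p₀ * ENNReal.ofReal (w₀ x)) ^
            ((1 - Θ) * p / p₀) * (∫⁻ x, dyadicSquareFunction s₁ q₁ a₁ x ^ p₁ *
            ENNReal.ofReal (w₁ x)) ^ (Θ * p / p₁)) ^ (1 / p) := by
        gcongr
        exact ENNReal.lintegral_mul_norm_pow_le
          (((measurable_dyadicSquareFunction s₀ hq₀ a₀).pow_const p₀).aemeasurable.mul hw₀m)
          (((measurable_dyadicSquareFunction s₁ hq₁ a₁).pow_const p₁).aemeasurable.mul hw₁m)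
          (by positivity) (by positivity) hmn
    _ = _ := by
        rw [ENNReal.mul_rpow_of_nonneg _ _ (by positivity), ← ENNReal.rpow_mul,
          ← ENNReal.rpow_mul, ← ENNReal.rpow_mul, ← ENNReal.rpow_mul]
        congr 2 <;> field_simp

/-- Every family in `f^s_{p,q}(w)` factorizes through `f^{s₀}_{p₀,q₀}(w₀)` and
`f^{s₁}_{p₁,q₁}(w₁)`. -/
lemma exists_factorization (hd : 1 ≤ d) (hΘ₀ : 0 < Θ) (hΘ₁ : Θ < 1) (hp₀ : 0 < p₀) (hp₁ : 0 < p₁)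
    (hp0 : 0 < p) (hp : 1 / p = (1 - Θ) / p₀ + Θ / p₁)
    {q₀ q₁ q : ℝ≥0∞} (hq₀ : 0 < q₀) (hq₁ : 0 < q₁)
    (hq : 1 / q = ENNReal.ofReal (1 - Θ) / q₀ + ENNReal.ofReal Θ / q₁)
    {s₀ s₁ s : ℝ} (hs : s = (1 - Θ) * s₀ + Θ * s₁)
    (hw₀ : IsLocalMuckenhouptInfty w₀) (hw₁ : IsLocalMuckenhouptInfty w₁)
    (hw : ∀ x, w x = w₀ x ^ ((1 - Θ) * p / p₀) * w₁ x ^ (Θ * p / p₁)) :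
    ∃ C₀ C₁ : ℝ≥0∞, C₀ ≠ ∞ ∧ C₁ ≠ ∞ ∧ ∀ a : ℕ × (Fin d → ℤ) → ℂ, fNorm s p q w a ≠ ∞ →
      ∃ a₀ a₁ : ℕ × (Fin d → ℤ) → ℂ, (∀ x, ‖a x‖ ≤ ‖a₀ x‖ ^ (1 - Θ) * ‖a₁ x‖ ^ Θ) ∧
        fNorm s₀ p₀ q₀ w₀ a₀ ^ p₀ ≤ C₀ * fNorm s p q w a ^ p ∧
        fNorm s₁ p₁ q₁ w₁ a₁ ^ p₁ ≤ C₁ * fNorm s p q w a ^ p := by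
  have hΘ : 0 < 1 - Θ := by linarith
  obtain ⟨r₀, hr₀, hw₀⟩ := hw₀
  obtain ⟨r₁, hr₁, hw₁⟩ := hw₁
  obtain ⟨hq0, hqt, -, hα⟩ := exponentRatio_eq hΘ₀ hΘ₁ hq₀ hq₁ hq
  obtain ⟨C₀, hC₀, h₀⟩ := hw₀.exists_fNorm_calderonFactor_le hd hr₀ hp₀ hq₀ hq0
    (fun h => (hqt.1 h).1) s₀ s p Θ hp0
  obtain ⟨C₁, hC₁, h₁⟩ := hw₁.exists_fNorm_calderonFactor_le hd hr₁ hp₁ hq₁ hq0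
    (fun h => (hqt.1 h).2) s₁ s p (-(1 - Θ)) hp0
  refine ⟨C₀, C₁, hC₀, hC₁, fun a ha => ?_⟩
  set α₀ := exponentRatio q q₀
  set α₁ := exponentRatio q q₁
  set g := dyadicSquareFunction s q a with hg
  have hgm : Measurable g := measurable_dyadicSquareFunction s hq0 a
  -- Measurable versions of the weights make u measurable, as the median lemma requires.
  obtain ⟨V₀, hV₀m, hV₀e⟩ := hw₀.aemeasurable
  obtain ⟨V₁, hV₁m, hV₁e⟩ := hw₁.aemeasurable
  have hW := ofReal_weight_eq hw₀.1 hw₁.1 (by positivity) (by positivity) hw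
  have hWm : AEMeasurable (fun x => ENNReal.ofReal (w x)) volume := by
    simp only [hW]
    exact (hw₀.aemeasurable.pow_const _).mul (hw₁.aemeasurable.pow_const _)
  have hint : ∫⁻ x, g x ^ p * ENNReal.ofReal (w x) ≠ ∞ := by
    intro h
    refine ha ?_
    rw [fNorm, weightedLpNorm, ← hg, h, ENNReal.top_rpow_of_pos (by positivity)]
  have hgood : ∀ᵐ x, g x ≠ ∞ ∧ (V₀ x = ENNReal.ofReal (w₀ x) ∧ V₁ x = ENNReal.ofReal (w₁ x)) ∧
      (V₀ x ≠ 0 ∧ V₀ x ≠ ∞) ∧ V₁ x ≠ 0 ∧ V₁ x ≠ ∞ := by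
    have hW0 : ∀ᵐ x, ENNReal.ofReal (w x) ≠ 0 := by
      filter_upwards [hw₀.ae_pos hd hr₀, hw₁.ae_pos hd hr₁] with x hx₀ hx₁
      rw [ENNReal.ofReal_ne_zero_iff, hw]
      positivity
    filter_upwards [ae_ne_top_of_lintegral_rpow_mul hp0 hgm hWm hW0 hint,
      hV₀e, hV₁e, hw₀.ae_pos hd hr₀,
      hw₁.ae_pos hd hr₁] with x hx hV₀ hV₁ hx₀ hx₁
    refine ⟨hx, ⟨hV₀.symm, hV₁.symm⟩, ?_, ?_⟩
    · rw [← hV₀]; simpa using hx₀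
    · rw [← hV₁]; simpa using hx₁
  -- The exponents solve (g^α₀ u^Θ)^p₀ w₀ = g^p w. The companion identity for the index 1 then
  -- follows from (1-Θ)α₀ + Θα₁ = 1 and the relation for p.
  set κ : ℝ := (p / p₀ - α₀) / Θ with hκ
  set γ : ℝ := p / (p₀ * p₁) with hγ
  set u : EuclideanSpace ℝ (Fin d) → ℝ≥0∞ := fun x => g x ^ κ * V₀ x ^ (-γ) * V₁ x ^ γ with hu
  have hum : Measurable u := ((hgm.pow_const _).mul (hV₀m.pow_const _)).mul (hV₁m.pow_const _)
  have hpΘ : (1 - Θ) * p / p₀ + Θ * p / p₁ = 1 := by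
    calc _ = ((1 - Θ) / p₀ + Θ / p₁) * p := by ring
      _ = 1 := by rw [← hp, one_div_mul_cancel hp0.ne']
  have hpΘ' : (1 - Θ) * p * p₁ + Θ * p * p₀ = p₀ * p₁ := by
    field_simp at hpΘ
    linarith
  have hmed : ∀ j k, ∃ m : ℝ≥0, m ≠ 0 ∧ (a (j, k) ≠ 0 →
      2⁻¹ * volume (dyadicCube j k) ≤ volume (dyadicCube j k ∩ {x | (m : ℝ≥0∞) ≤ u x}) ∧
      2⁻¹ * volume (dyadicCube j k) ≤ volume (dyadicCube j k ∩ {x | u x ≤ m})) := by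
    intro j k
    by_cases hajk : a (j, k) = 0
    · exact ⟨1, one_ne_zero, fun h => absurd hajk h⟩
    have hae : ∀ᵐ x, x ∈ dyadicCube j k → u x ≠ 0 ∧ u x ≠ ∞ := by
      filter_upwards [hgood] with x ⟨hgt, _, ⟨hV₀0, hV₀t⟩, hV₁0, hV₁t⟩ hxQ
      -- On a cube with nonzero coefficient g ≥ c_Q > 0, which keeps u away from 0 and ∞ almost
      -- everywhere there.
      have hg0 : g x ≠ 0 := by
        have hle := dyadicCoeff_le_dyadicSquareFunction s hq0 a j x
        rw [mem_dyadicCube_iff.1 hxQ] at hle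
        refine ((ENNReal.coe_pos.2 (pos_iff_ne_zero.2 ?_)).trans_le hle).ne'
        exact dyadicCoeff_eq_zero_iff.not.2 hajk
      simp [hu, hg0, hgt, hV₀0, hV₀t, hV₁0, hV₁t, ENNReal.mul_eq_top, ENNReal.rpow_eq_zero_iff,
        ENNReal.rpow_eq_top_iff]
    obtain ⟨m, hm, hm'⟩ := exists_median_of_ae (measurableSet_dyadicCube j k)
      (volume_dyadicCube j k).2 (volume_dyadicCube j k).1 hum hae
    exact ⟨m, hm, fun _ => hm'⟩
  choose M hM hMmed using hmed
  refine ⟨_, _, norm_le_calderonFactor hs hα hM a,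
    h₀ w (fun j k => {x | (M j k : ℝ≥0∞) ≤ u x}) M u a ?_ hM (fun j k h => (hMmed j k h).1) ?_ ?_,
    h₁ w (fun j k => {x | u x ≤ M j k}) M u a ?_ hM (fun j k h => (hMmed j k h).2) ?_ ?_⟩
  · exact fun j k => measurableSet_le measurable_const hum
  · exact fun j k x hx => ENNReal.rpow_le_rpow hx hΘ₀.le
  · filter_upwards [hgood] with x ⟨hgt, ⟨hV₀, hV₁⟩, ⟨hV₀0, hV₀t⟩, hV₁0, hV₁t⟩ hg0
    have := ENNReal.rpow_mul_monomial hg0 hgt hV₀0 hV₀t hV₁0 hV₁t α₀ κ γ (-γ) Θ p₀ 1 0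
    rw [ENNReal.rpow_one, ENNReal.rpow_zero, mul_one] at this
    rw [hW, ← hV₀, ← hV₁, this]
    refine le_of_eq ?_
    congr 2
    · rw [hκ]; field_simp; ring
    · congr 1
      rw [hγ]; field_simp; linarith
    · congr 1
      rw [hγ]; field_simp; ring
  · exact fun j k => measurableSet_le hum measurable_const
  · exact fun j k x hx => ENNReal.rpow_neg_le_rpow_neg hx hΘ.le
  · filter_upwards [hgood] with x ⟨hgt, ⟨hV₀, hV₁⟩, ⟨hV₀0, hV₀t⟩, hV₁0, hV₁t⟩ hg0
    have := ENNReal.rpow_mul_monomial hg0 hgt hV₀0 hV₀t hV₁0 hV₁t α₁ κ γ (-γ) (-(1 - Θ)) p₁ 0 1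
    rw [ENNReal.rpow_one, ENNReal.rpow_zero, one_mul] at this
    rw [hW, ← hV₀, ← hV₁, this]
    refine le_of_eq ?_
    congr 2
    · have hκΘ : κ * Θ = p / p₀ - α₀ := div_mul_cancel₀ _ hΘ₀.ne'
      have : α₁ + κ * -(1 - Θ) = p / p₁ := by
        refine mul_left_cancel₀ hΘ₀.ne' ?_
        linear_combination hα - hpΘ - (1 - Θ) * hκΘ
      rw [this, div_mul_cancel₀ _ hp₁.ne']
    · congr 1
      rw [hγ]; field_simp; ring
    · congr 1
      rw [hγ]; field_simp; linarith

end Factorization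

/-! ### Equality of the spaces and equivalence of the quasi-norms -/

theorem theorem8 {d : ℕ} (hd : 1 ≤ d) (Θ : ℝ) (hΘ₀ : 0 < Θ) (hΘ₁ : Θ < 1)
    (p₀ p₁ p : ℝ) (hp₀ : 0 < p₀) (hp₁ : 0 < p₁)
    (q₀ q₁ q : ℝ≥0∞) (hq₀ : 0 < q₀) (hq₁ : 0 < q₁)
    (s₀ s₁ s : ℝ)
    (hp : 1 / p = (1 - Θ) / p₀ + Θ / p₁)
    (hq : 1 / q = ENNReal.ofReal (1 - Θ) / q₀ + ENNReal.ofReal Θ / q₁)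
    (hs : s = (1 - Θ) * s₀ + Θ * s₁)
    (w₀ w₁ w : EuclideanSpace ℝ (Fin d) → ℝ)
    (hw₀ : IsLocalMuckenhouptInfty w₀) (hw₁ : IsLocalMuckenhouptInfty w₁)
    (hw : ∀ x, w x = w₀ x ^ ((1 - Θ) * p / p₀) * w₁ x ^ (Θ * p / p₁)) :
    calderonProduct Measure.count Θ (fNorm s₀ p₀ q₀ w₀) (fNorm s₁ p₁ q₁ w₁) = fSpace s p q w ∧
    ∃ c C : ℝ, 0 < c ∧ 0 < C ∧ ∀ a ∈ fSpace s p q w,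
      ENNReal.ofReal c * fNorm s p q w a ≤
          calderonNorm Measure.count Θ (fNorm s₀ p₀ q₀ w₀) (fNorm s₁ p₁ q₁ w₁) a ∧
        calderonNorm Measure.count Θ (fNorm s₀ p₀ q₀ w₀) (fNorm s₁ p₁ q₁ w₁) a ≤
          ENNReal.ofReal C * fNorm s p q w a := by
  have hΘ : 0 < 1 - Θ := by linarith
  have hp0 : 0 < p := one_div_pos.1 (by rw [hp]; positivity)
  have hlow : ∀ a, fNorm s p q w a ≤
      calderonNorm Measure.count Θ (fNorm s₀ p₀ q₀ w₀) (fNorm s₁ p₁ q₁ w₁) a := by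
    intro a
    obtain ⟨r₀, -, hw₀⟩ := hw₀
    obtain ⟨r₁, -, hw₁⟩ := hw₁
    refine le_iInf fun a₀ => le_iInf fun a₁ => le_iInf fun _ => le_iInf fun _ => le_iInf fun h => ?_
    rw [Measure.ae_count_iff] at h
    exact fNorm_le_of_norm_le hΘ₀ hΘ₁ hp₀ hp₁ hp0 hp hq₀ hq₁ hq hs hw₀.1 hw₁.1 hw₀.aemeasurable
      hw₁.aemeasurable hw h
  obtain ⟨C₀, C₁, hC₀, hC₁, hfac⟩ :=
    exists_factorization hd hΘ₀ hΘ₁ hp₀ hp₁ hp0 hp hq₀ hq₁ hq hs hw₀ hw₁ hw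
  -- Obtained by taking the p_i-th roots of the two factor bounds and then the powers 1-Θ and Θ; the
  -- resulting exponents of `fNorm s p q w a` add up to 1.
  set K : ℝ≥0∞ := C₀ ^ (1 / p₀ * (1 - Θ)) * C₁ ^ (1 / p₁ * Θ) with hK
  have hKt : K ≠ ∞ := ENNReal.mul_ne_top (ENNReal.rpow_ne_top_of_nonneg (by positivity) hC₀)
    (ENNReal.rpow_ne_top_of_nonneg (by positivity) hC₁)
  have hup : ∀ a, fNorm s p q w a ≠ ∞ →
      calderonNorm Measure.count Θ (fNorm s₀ p₀ q₀ w₀) (fNorm s₁ p₁ q₁ w₁) a ≤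
        K * fNorm s p q w a := by
    intro a ha
    obtain ⟨a₀, a₁, hle, h₀, h₁⟩ := hfac a ha
    have hroot : ∀ {x C : ℝ≥0∞} {t : ℝ}, 0 < t → x ^ t ≤ C * fNorm s p q w a ^ p →
        x ≤ C ^ (1 / t) * fNorm s p q w a ^ (p / t) := by
      intro x C t ht h
      have := ENNReal.rpow_le_rpow h (one_div_nonneg.2 ht.le)
      rwa [← ENNReal.rpow_mul, mul_one_div_cancel ht.ne', ENNReal.rpow_one,
        ENNReal.mul_rpow_of_nonneg _ _ (by positivity), ← ENNReal.rpow_mul, mul_one_div] at this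
    have h₀' := hroot hp₀ h₀
    have h₁' := hroot hp₁ h₁
    have hmem : ∀ {x C : ℝ≥0∞} {t : ℝ}, 0 < t → C ≠ ∞ →
        x ≤ C ^ (1 / t) * fNorm s p q w a ^ (p / t) → x < ∞ := by
      intro x C t ht hC h
      refine h.trans_lt (ENNReal.mul_lt_top ?_ ?_)
      · exact (ENNReal.rpow_ne_top_of_nonneg (by positivity) hC).lt_top
      · exact (ENNReal.rpow_ne_top_of_nonneg (by positivity) ha).lt_top
    have hN : calderonNorm Measure.count Θ (fNorm s₀ p₀ q₀ w₀) (fNorm s₁ p₁ q₁ w₁) a ≤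
        fNorm s₀ p₀ q₀ w₀ a₀ ^ (1 - Θ) * fNorm s₁ p₁ q₁ w₁ a₁ ^ Θ := by
      refine iInf_le_of_le a₀ ?_
      refine iInf_le_of_le a₁ ?_
      refine iInf_le_of_le ⟨Measurable.of_discrete.aemeasurable, hmem hp₀ hC₀ h₀'⟩ ?_
      refine iInf_le_of_le ⟨Measurable.of_discrete.aemeasurable, hmem hp₁ hC₁ h₁'⟩ ?_
      exact iInf_le _ (Filter.Eventually.of_forall hle)
    refine hN.trans ?_
    calc _ ≤ (C₀ ^ (1 / p₀) * fNorm s p q w a ^ (p / p₀)) ^ (1 - Θ) *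
          (C₁ ^ (1 / p₁) * fNorm s p q w a ^ (p / p₁)) ^ Θ := by gcongr
      _ = K * (fNorm s p q w a ^ (p / p₀ * (1 - Θ)) * fNorm s p q w a ^ (p / p₁ * Θ)) := by
        rw [ENNReal.mul_rpow_of_nonneg _ _ hΘ.le, ENNReal.mul_rpow_of_nonneg _ _ hΘ₀.le,
          ← ENNReal.rpow_mul, ← ENNReal.rpow_mul, ← ENNReal.rpow_mul, ← ENNReal.rpow_mul,
          mul_mul_mul_comm]
      _ = K * fNorm s p q w a := by
        have : p / p₀ * (1 - Θ) + p / p₁ * Θ = 1 := by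
          calc _ = ((1 - Θ) / p₀ + Θ / p₁) * p := by ring
            _ = 1 := by rw [← hp, one_div_mul_cancel hp0.ne']
        rw [← ENNReal.rpow_add_of_nonneg _ _ (by positivity) (by positivity), this,
          ENNReal.rpow_one]
  -- `K` may vanish, so 1 is added to make the upper constant positive.
  refine ⟨Set.ext fun a => ⟨fun h => ⟨h.1, (hlow a).trans_lt h.2⟩, fun h => ⟨h.1, ?_⟩⟩,
    1, K.toReal + 1, one_pos, by positivity, fun a ha => ⟨?_, ?_⟩⟩
  · exact (hup a h.2.ne).trans_lt (ENNReal.mul_lt_top hKt.lt_top h.2)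
  · rw [ENNReal.ofReal_one, one_mul]
    exact hlow a
  · refine (hup a ha.2.ne).trans ?_
    gcongr
    rw [← ENNReal.ofReal_toReal hKt]
    exact ENNReal.ofReal_le_ofReal (by simp)
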